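/- **Constants.** The equation $$\int_{\alpha}^{1}\frac{\ln\alpha+1}{(\ln\alpha+1)(-x\ln x+x)-\alpha}\,dx+\frac1{\ln\alpha}=0$$ has a unique solution $\alpha\in(0,1)$; one has $|\alpha-0.211|<0.0005$, and $\Gamma:=\frac{\ln\alpha+1}{\ln\alpha+1-\alpha}$ satisfies $|\Gamma-0.725|<0.0005$. **Setting.** Let $n\ge1$ and let $v_1,\dots,v_n$ be independent nonnegative random variables, $v_i\sim D_i$, where each $D_i$ is a continuous (atomless) probability distribution. A threshold function is a map $\tau:[0,1]\to[-\infty,\infty]$ with $\Pr[\max_i v_i>\tau(t)]=t$ for all $t\in[0,1]$, where $\tau(1)$ is the largest $x$ with $\Pr[\max_i v_i>x]=1$. Given $\tau$, put $$p_i(t)=\Pr[v_i>\tau(t)],\quad q_i(t)=\Pr[\max_{j\ne i}v_j>\tau(t)],\quad g(t)=\Gamma\Big(\sum_i(1-q_i(t))p_i(t)-t\Big)+1,$$ $$f_i(t)=\Gamma\,\frac{q_i'(t)}{g(t)}\exp\Big(-\Gamma\int_0^t\frac{q_i'(s)p_i(s)}{g(s)}\,ds\Big)$$ (with $q_i'$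 the almost everywhere defined derivative, set to $0$ where $q_i$ is not differentiable; $q_i=0$ if $n=1$). Let $F_i$ be the distribution on $[0,1]$ with density $f_i$ on $[0,1)$ and a point mass $1-\int_0^1f_i$ at $1$. **Algorithm.** Fix an item $i_1$ with $p_{i_1}(1)=1$. Draw arrival times $t_i\sim F_i$, independent of each other and of the values. The items arrive in ascending order of arrival times. An item $i$ arriving at time $t_i<1$ is accepted if $v_i>\tau(t_i)$; at time $1$ every item other than $i_1$ is rejected, while $i_1$ is accepted whatever its value. The algorithm stops at the first accepted item. Let $\mathsf{ALG}$ be the value of the accepted item, and $0$ if there is none. **Theorem.** A threshold function exists. For every threshold function $\tau$, each $f_i$ is nonnegative on $[0,1)$, each $F_i$ is a probability distribution, and an item $i_1$ as above exists. For every choice of such an item, $$\Pr[\mathsf{ALG}>\tau(t)]\ \ge\ \Gamma\, t=\Gamma\cdot\Pr[\max_i v_i>\tau(t)]\quad\text{for all }t\in[0,1],$$ and $$\mathbb E[\mathsf{ALG}]\ \ge\ \Gamma\cdot\mathbb E[\max_i v_i]$$ (both expectations taken in $[0,\infty]$). In particular, the independent arrival time algorithm is $\Gamma\approx0.725$-competitive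 for the order-selection prophet inequality. -/

import Mathlib

open MeasureTheory

namespace OrderSelection

/-- The equation that determines the constant `α`; its solution is sought in `(0, 1)`. -/
def AlphaEq (α : ℝ) : Prop :=
  (∫ x in α..1, (Real.log α + 1) /
      ((Real.log α + 1) * (-x * Real.log x + x) - α)) + 1 / Real.log α = 0

/-- The competitive ratio `Γ`, as a function of `α`. -/
noncomputable def ratio (α : ℝ) : ℝ := (Real.log α + 1) / (Real.log α + 1 - α)

/-- The largest of the values `v i` (used for `n ≥ 1`). -/
noncomputable def maxVal {n : ℕ} (v : Fin n → ℝ) : ℝ := ⨆ i, v i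

/-- `τ` is a threshold function for independent values `v i ∼ D i`: the probability that the
largest value exceeds `τ t` is `t`, for every `t ∈ [0, 1]`.  Thresholds are extended reals,
because `τ 0 = ∞` is forced when the values are unbounded.  At `t = 1` the equation leaves a
choice that matters, and `τ 1` is the largest solution; this is what makes the functions
`exceedProb` and `othersProb` below continuous at `t = 1`. -/
structure IsThreshold {n : ℕ} (D : Fin n → Measure ℝ) (τ : ℝ → EReal) : Prop where
  prob_eq : ∀ t ∈ Set.Icc (0 : ℝ) 1,
    (Measure.pi D).real {v | τ t < (maxVal v : EReal)} = t
  greatest_one : ∀ x : EReal,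
    (Measure.pi D).real {v | x < (maxVal v : EReal)} = 1 → x ≤ τ 1

/-- `p i t`, the probability that `v i > τ t`. -/
noncomputable def exceedProb {n : ℕ} (D : Fin n → Measure ℝ) (τ : ℝ → EReal)
    (i : Fin n) (t : ℝ) : ℝ :=
  (D i).real {x | τ t < (x : EReal)}

/-- `q i t`, the probability that the largest of the values `v j`, `j ≠ i`, exceeds `τ t`. -/
noncomputable def othersProb {n : ℕ} (D : Fin n → Measure ℝ) (τ : ℝ → EReal)
    (i : Fin n) (t : ℝ) : ℝ :=
  (Measure.pi D).real {v | ∃ j, j ≠ i ∧ τ t < (v j : EReal)}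

/-- The auxiliary function `g`. -/
noncomputable def auxG {n : ℕ} (Γ : ℝ) (D : Fin n → Measure ℝ) (τ : ℝ → EReal) (t : ℝ) : ℝ :=
  Γ * ((∑ i, (1 - othersProb D τ i t) * exceedProb D τ i t) - t) + 1

/-- The density `f i` of the arrival time of item `i` on `[0, 1)`. -/
noncomputable def arrivalDensity {n : ℕ} (Γ : ℝ) (D : Fin n → Measure ℝ) (τ : ℝ → EReal)
    (i : Fin n) (t : ℝ) : ℝ :=
  Γ * (deriv (othersProb D τ i) t / auxG Γ D τ t) *
    Real.exp (-Γ * ∫ s in (0 : ℝ)..t,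
      deriv (othersProb D τ i) s * exceedProb D τ i s / auxG Γ D τ s)

/-- The arrival time distribution `F i`: density `f i` on `[0, 1)`, and the remaining mass
`1 - ∫ f i` at time `1`. -/
noncomputable def arrivalLaw {n : ℕ} (Γ : ℝ) (D : Fin n → Measure ℝ) (τ : ℝ → EReal)
    (i : Fin n) : Measure ℝ :=
  (volume.restrict (Set.Ico (0 : ℝ) 1)).withDensity
      (fun t => ENNReal.ofReal (arrivalDensity Γ D τ i t)) +
    ENNReal.ofReal (1 - ∫ t in Set.Ico (0 : ℝ) 1, arrivalDensity Γ D τ i t) •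
      Measure.dirac (1 : ℝ)

/-- Item `i` is acceptable if it arrives at a time `t i < 1` and its value exceeds `τ (t i)`.
An item that arrives at time `1` is rejected unless it is the special item `i₁`, which is then
acceptable whatever its value. -/
def Acceptable {n : ℕ} (τ : ℝ → EReal) (i₁ : Fin n) (v t : Fin n → ℝ) (i : Fin n) : Prop :=
  (t i ∈ Set.Ico (0 : ℝ) 1 ∧ τ (t i) < (v i : EReal)) ∨ (i = i₁ ∧ t i = 1)

/-- The algorithm accepts the first acceptable item in the order of the arrival times
(simultaneous arrivals are ordered by index). -/
def Accepts {n : ℕ} (τ : ℝ → EReal) (i₁ : Fin n) (v t : Fin n → ℝ) (i : Fin n) : Prop :=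
  Acceptable τ i₁ v t i ∧
    ∀ j, j ≠ i → Acceptable τ i₁ v t j → t i < t j ∨ (t i = t j ∧ i < j)

open Classical in
/-- The value of the accepted item, and `0` if no item is accepted. -/
noncomputable def algValue {n : ℕ} (τ : ℝ → EReal) (i₁ : Fin n) (v t : Fin n → ℝ) : ℝ :=
  ∑ i, if Accepts τ i₁ v t i then v i else 0

/-- The joint law of the values and the arrival times, which are all independent:
`v i ∼ D i` and `t i ∼ F i`. -/
noncomputable def runLaw {n : ℕ} (Γ : ℝ) (D : Fin n → Measure ℝ) (τ : ℝ → EReal) :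
    Measure ((Fin n → ℝ) × (Fin n → ℝ)) :=
  (Measure.pi D).prod (Measure.pi (arrivalLaw Γ D τ))

end OrderSelection

namespace OrderSelection

open Set Filter Topology

/-! Put S_i(t) = exp(-Γ ∫₀ᵗ q_i' p_i / g) (`surv`). The density f_i satisfies f_i p_i = -S_i' almost
everywhere, so S_i(t) is the probability that item i has not been acceptable up to time t.
Differentiating ∏ (1 - p_j) = 1 - t gives Σ (1 - q_i) p_i' = 1, hence g' = -Γ Σ q_i' p_i, hence ∏
S_i = g (`prod_surv`). Therefore f_i ∏_{j≠i} S_j = Γ q_i': at time s, item i is the first acceptable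
one and has value above τ(t) at rate Γ q_i'(s) p_i(min(s, t)). Integrated over s and summed over i,
this is Γ t - Γ (1 - q_{i₁}(1)) p_{i₁}(t). The missing term has to come from the arrival of i₁ at
time 1 (`le_total`).

What remains is that each f_i has mass at most 1 and that enough mass of i₁ is left at time 1. Both
follow from 1 - ∫₀¹ f_i ≥ B(1 - q_i(1)) S_i(1) for a barrier function B (`IsBarrier`, `barrier_le`).
This inequality is propagated from t = 0 by a comparison of derivatives, using the lower bound g ≥ 1
- Γ + Γ(x - (1 - p_i) x log x) with x = 1 - q_i (`g_ge`). On [α, 1] the barrier solves B' = Γ / (1 -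
Γ + Γ(x - x log x)), which is the case p_i = 0. On [0, α] it is Γ x / (1 - Γ + Γ x), exactly what
the end condition requires. The formula for Γ in terms of α makes the two derivatives agree at α,
and the integral equation for α makes the two values agree.

The equation for α compares a quantity decreasing in α with an increasing one, which gives
uniqueness. Two quadrature bounds enclose U = -log α in [1.5554, 1.557].

The bound on the expectation is the layer-cake formula. A level x that need not be a threshold is
compared with the threshold of t = Pr[max v_i > x], which is no less selective for any single item
up to null sets (`exceedProb_le_tailProb`). -/

/-! ### Absolutely continuous functions on an interval. -/

theorem absolutelyContinuousOnInterval_const (c a b : ℝ) :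
    AbsolutelyContinuousOnInterval (fun _ : ℝ => c) a b :=
  (LipschitzWith.const (α := ℝ) c).lipschitzOnWith.absolutelyContinuousOnInterval

theorem absolutelyContinuousOnInterval_id (a b : ℝ) :
    AbsolutelyContinuousOnInterval (fun x : ℝ => x) a b :=
  (LipschitzWith.id (α := ℝ)).lipschitzOnWith.absolutelyContinuousOnInterval

theorem absolutelyContinuousOnInterval_sum {ι : Type*} {f : ι → ℝ → ℝ} {a b : ℝ}
    (s : Finset ι) (h : ∀ i ∈ s, AbsolutelyContinuousOnInterval (f i) a b) :
    AbsolutelyContinuousOnInterval (fun x => ∑ i ∈ s, f i x) a b := by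
  classical
  induction s using Finset.induction_on with
  | empty => simpa using absolutelyContinuousOnInterval_const 0 a b
  | insert i s hi ih =>
    simp only [Finset.sum_insert hi]
    exact (h i (by simp)).add (ih fun j hj => h j (by simp [hj]))

theorem AbsolutelyContinuousOnInterval.comp_lipschitzOnWith {f φ : ℝ → ℝ} {a b : ℝ}
    {K : NNReal} (hf : AbsolutelyContinuousOnInterval f a b)
    (hφ : LipschitzOnWith K φ (f '' uIcc a b)) :
    AbsolutelyContinuousOnInterval (fun x => φ (f x)) a b := by
  rw [absolutelyContinuousOnInterval_iff] at hf ⊢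
  intro ε hε
  obtain ⟨δ, hδ, h⟩ := hf (ε / (K + 1)) (by positivity)
  refine ⟨δ, hδ, fun E hE hlt => ?_⟩
  have h1 := h E hE hlt
  have hmem : ∀ i ∈ Finset.range E.1, (E.2 i).1 ∈ uIcc a b ∧ (E.2 i).2 ∈ uIcc a b :=
    fun i hi => hE.1 i hi
  calc ∑ i ∈ Finset.range E.1, dist (φ (f (E.2 i).1)) (φ (f (E.2 i).2))
      ≤ ∑ i ∈ Finset.range E.1, (K + 1) * dist (f (E.2 i).1) (f (E.2 i).2) := by
        refine Finset.sum_le_sum fun i hi => ?_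
        refine (hφ.dist_le_mul _ (mem_image_of_mem f (hmem i hi).1) _
          (mem_image_of_mem f (hmem i hi).2)).trans ?_
        gcongr
        simp
    _ = (K + 1) * ∑ i ∈ Finset.range E.1, dist (f (E.2 i).1) (f (E.2 i).2) := by
        rw [Finset.mul_sum]
    _ < (K + 1) * (ε / (K + 1)) := by gcongr
    _ = ε := by field_simp

theorem AbsolutelyContinuousOnInterval.congr {f g : ℝ → ℝ} {a b : ℝ}
    (hf : AbsolutelyContinuousOnInterval f a b) (h : EqOn f g (uIcc a b)) :
    AbsolutelyContinuousOnInterval g a b := by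
  rw [absolutelyContinuousOnInterval_iff] at hf ⊢
  intro ε hε
  obtain ⟨δ, hδ, h'⟩ := hf ε hε
  refine ⟨δ, hδ, fun E hE hlt => ?_⟩
  convert h' E hE hlt using 1
  refine Finset.sum_congr rfl fun i hi => ?_
  rw [h (hE.1 i hi).1, h (hE.1 i hi).2]

/-- A continuous function is absolutely continuous as soon as it is absolutely continuous on
each smaller interval and has an integrable derivative. -/
theorem AbsolutelyContinuousOnInterval.of_forall_lt {f : ℝ → ℝ} {a b : ℝ} (hab : a < b)
    (hc : ContinuousOn f (Icc a b)) (hi : IntervalIntegrable (deriv f) volume a b)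
    (h : ∀ c ∈ Ico a b, AbsolutelyContinuousOnInterval f a c) :
    AbsolutelyContinuousOnInterval f a b := by
  have hAC := hi.absolutelyContinuousOnInterval_intervalIntegral (c := a) (by simp)
  have hconst : AbsolutelyContinuousOnInterval (fun _ : ℝ => f a) a b :=
    absolutelyContinuousOnInterval_const _ _ _
  refine AbsolutelyContinuousOnInterval.congr (hconst.add hAC) ?_
  rw [uIcc_of_le hab.le]
  have hIco : EqOn ((fun _ : ℝ => f a) + fun x => ∫ v in a..x, deriv f v) f (Ico a b) := by
    intro c hc
    simp only [Pi.add_apply]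
    rw [(h c hc).integral_deriv_eq_sub]
    ring
  have h2 : ContinuousOn ((fun _ : ℝ => f a) + fun x => ∫ v in a..x, deriv f v) (Icc a b) := by
    have := (hconst.add hAC).continuousOn
    rwa [uIcc_of_le hab.le] at this
  intro c hcc
  rcases eq_or_lt_of_le hcc.2 with rfl | hlt
  · have hne : (𝓝[Ico a c] c).NeBot := by
      rw [← mem_closure_iff_nhdsWithin_neBot, closure_Ico hab.ne]
      exact hcc
    have t1 := (h2 c hcc).mono_left (nhdsWithin_mono _ Ico_subset_Icc_self)
    have t2 := (hc c hcc).mono_left (nhdsWithin_mono _ Ico_subset_Icc_self)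
    exact tendsto_nhds_unique (t1.congr' (eventually_nhdsWithin_of_forall hIco)) t2
  · exact hIco ⟨hcc.1, hlt⟩

/-- The fundamental theorem of calculus in the form needed here: the q_i are differentiable only
almost everywhere, so every derivative formula below holds only almost everywhere. -/
theorem AbsolutelyContinuousOnInterval.integral_eq_sub_of_ae_hasDerivAt {f f' : ℝ → ℝ}
    {a b : ℝ} (hab : a ≤ b) (hf : AbsolutelyContinuousOnInterval f a b)
    (h : ∀ᵐ x, x ∈ Ioo a b → HasDerivAt f (f' x) x) :
    ∫ x in a..b, f' x = f b - f a := by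
  rw [← hf.integral_deriv_eq_sub]
  refine intervalIntegral.integral_congr_ae ?_
  have hb : ∀ᵐ x : ℝ, x ≠ b := by simp [ae_iff, measure_singleton]
  filter_upwards [h, hb] with x hx hxb hmem
  rw [uIoc_of_le hab] at hmem
  exact (hx ⟨hmem.1, lt_of_le_of_ne hmem.2 hxb⟩).deriv.symm

theorem AbsolutelyContinuousOnInterval.le_of_ae_hasDerivAt_nonneg {f f' : ℝ → ℝ}
    {a b : ℝ} (hab : a ≤ b) (hf : AbsolutelyContinuousOnInterval f a b)
    (h : ∀ᵐ x, x ∈ Ioo a b → HasDerivAt f (f' x) x)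
    (h0 : ∀ᵐ x, x ∈ Ioo a b → 0 ≤ f' x) : f a ≤ f b := by
  have := AbsolutelyContinuousOnInterval.integral_eq_sub_of_ae_hasDerivAt hab hf h
  have h1 : 0 ≤ ∫ x in a..b, f' x := by
    refine intervalIntegral.integral_nonneg_of_ae_restrict hab ?_
    rw [EventuallyLE, ae_restrict_iff' measurableSet_Icc]
    have ha : ∀ᵐ x : ℝ, x ≠ a := by simp [ae_iff, measure_singleton]
    have hb : ∀ᵐ x : ℝ, x ≠ b := by simp [ae_iff, measure_singleton]
    filter_upwards [h0, ha, hb] with x hx hxa hxb hmem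
    exact hx ⟨lt_of_le_of_ne hmem.1 hxa.symm, lt_of_le_of_ne hmem.2 hxb⟩
  linarith

/-! ### Exceedance probabilities, survival functions and arrival densities. -/

/-- The properties of the functions `p i` (`exceedProb`) and `q i` (`othersProb`) on `[0, 1]`
that the analysis of the arrival times needs. -/
structure ExceedSystem {n : ℕ} (p q : Fin n → ℝ → ℝ) : Prop where
  p_mem : ∀ i, ∀ t ∈ Icc (0 : ℝ) 1, p i t ∈ Icc (0 : ℝ) 1
  p_mono : ∀ i, MonotoneOn (p i) (Icc (0 : ℝ) 1)
  p_cont : ∀ i, ContinuousWithinAt (p i) (Icc (0 : ℝ) 1) 1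
  prod_eq : ∀ t ∈ Icc (0 : ℝ) 1, ∏ j, (1 - p j t) = 1 - t
  q_eq : ∀ i, ∀ t ∈ Icc (0 : ℝ) 1, 1 - q i t = ∏ j ∈ Finset.univ.erase i, (1 - p j t)
  q_nonneg : ∀ i t, 0 ≤ q i t

/-- The function `g` in terms of `p` and `q`. -/
noncomputable def gFun {n : ℕ} (Γ : ℝ) (p q : Fin n → ℝ → ℝ) (t : ℝ) : ℝ :=
  Γ * ((∑ i, (1 - q i t) * p i t) - t) + 1

/-- The probability that item `i` is not acceptable before time `t`. -/
noncomputable def surv {n : ℕ} (Γ : ℝ) (p q : Fin n → ℝ → ℝ) (i : Fin n) (t : ℝ) : ℝ :=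
  Real.exp (-Γ * ∫ s in (0 : ℝ)..t, deriv (q i) s * p i s / gFun Γ p q s)

/-- The density of the arrival time of item `i` in terms of `p` and `q`. -/
noncomputable def dens {n : ℕ} (Γ : ℝ) (p q : Fin n → ℝ → ℝ) (i : Fin n) (t : ℝ) : ℝ :=
  Γ * (deriv (q i) t / gFun Γ p q t) * surv Γ p q i t

theorem surv_pos {n : ℕ} (Γ : ℝ) (p q : Fin n → ℝ → ℝ) (i : Fin n) (t : ℝ) :
    0 < surv Γ p q i t := Real.exp_pos _

namespace ExceedSystem

variable {n : ℕ} {p q : Fin n → ℝ → ℝ} {Γ : ℝ}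

theorem one_sub_mul (h : ExceedSystem p q) (i : Fin n) {t : ℝ} (ht : t ∈ Icc (0 : ℝ) 1) :
    (1 - p i t) * (1 - q i t) = 1 - t := by
  rw [h.q_eq i t ht, Finset.mul_prod_erase _ (fun j => 1 - p j t) (Finset.mem_univ i),
    h.prod_eq t ht]

theorem q_mem (h : ExceedSystem p q) (i : Fin n) {t : ℝ} (ht : t ∈ Icc (0 : ℝ) 1) :
    q i t ∈ Icc (0 : ℝ) 1 := by
  refine ⟨h.q_nonneg i t, ?_⟩
  have : 0 ≤ ∏ j ∈ Finset.univ.erase i, (1 - p j t) :=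
    Finset.prod_nonneg fun j _ => sub_nonneg.2 (h.p_mem j t ht).2
  linarith [h.q_eq i t ht]

theorem q_mono (h : ExceedSystem p q) (i : Fin n) : MonotoneOn (q i) (Icc (0 : ℝ) 1) := by
  intro s hs t ht hst
  have : ∏ j ∈ Finset.univ.erase i, (1 - p j t) ≤ ∏ j ∈ Finset.univ.erase i, (1 - p j s) :=
    Finset.prod_le_prod (fun j _ => sub_nonneg.2 (h.p_mem j t ht).2)
      fun j _ => by linarith [h.p_mono j hs ht hst]
  linarith [h.q_eq i t ht, h.q_eq i s hs]

theorem q_cont (h : ExceedSystem p q) (i : Fin n) :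
    ContinuousWithinAt (q i) (Icc (0 : ℝ) 1) 1 := by
  have h1 : ContinuousWithinAt (fun t => 1 - ∏ j ∈ Finset.univ.erase i, (1 - p j t))
      (Icc (0 : ℝ) 1) 1 :=
    continuousWithinAt_const.sub (tendsto_finsetProd _ fun j _ =>
      continuousWithinAt_const.sub (h.p_cont j))
  refine h1.congr (fun t ht => ?_) ?_
  · linarith [h.q_eq i t ht]
  · linarith [h.q_eq i 1 (by simp)]

theorem one_sub_le_one_sub_p (h : ExceedSystem p q) (i : Fin n) {t : ℝ}
    (ht : t ∈ Icc (0 : ℝ) 1) : 1 - t ≤ 1 - p i t := by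
  have h1 := h.one_sub_mul i ht
  have h2 := h.q_mem i ht
  have h3 := h.p_mem i t ht
  nlinarith [h1, mul_nonneg (sub_nonneg.2 h3.2) h2.1]

theorem one_sub_le_one_sub_q (h : ExceedSystem p q) (i : Fin n) {t : ℝ}
    (ht : t ∈ Icc (0 : ℝ) 1) : 1 - t ≤ 1 - q i t := by
  have h1 := h.one_sub_mul i ht
  have h2 := h.q_mem i ht
  have h3 := h.p_mem i t ht
  nlinarith [h1, mul_nonneg (sub_nonneg.2 h2.2) h3.1]

theorem p_zero (h : ExceedSystem p q) (i : Fin n) : p i 0 = 0 := by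
  have h1 := h.one_sub_le_one_sub_p i (t := 0) (by simp)
  have h2 := (h.p_mem i 0 (by simp)).1
  linarith

theorem q_zero (h : ExceedSystem p q) (i : Fin n) : q i 0 = 0 := by
  have h1 := h.one_sub_le_one_sub_q i (t := 0) (by simp)
  have h2 := (h.q_mem i (t := 0) (by simp)).1
  linarith

/-- The increment bound makes f Lipschitz on [0, T] with constant 1 / (1 - T), which degenerates as
T tends to 1. -/
theorem ac_of_increment_of_lt {f : ℝ → ℝ} (hm : MonotoneOn f (Icc (0 : ℝ) 1))
    (hf : ∀ s ∈ Icc (0 : ℝ) 1, ∀ t ∈ Icc (0 : ℝ) 1, s ≤ t → (f t - f s) * (1 - t) ≤ t - s)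
    {T : ℝ} (hT : T ∈ Ico (0 : ℝ) 1) :
    AbsolutelyContinuousOnInterval f 0 T := by
  have hT1 : 0 < 1 - T := sub_pos.2 hT.2
  have : LipschitzOnWith (Real.toNNReal (1 / (1 - T))) f (uIcc 0 T) := by
    rw [uIcc_of_le hT.1]
    refine LipschitzOnWith.of_le_add_mul _ fun x hx y hy => ?_
    rw [Real.coe_toNNReal _ (by positivity), Real.dist_eq]
    have hx' : x ∈ Icc (0 : ℝ) 1 := ⟨hx.1, hx.2.trans hT.2.le⟩
    have hy' : y ∈ Icc (0 : ℝ) 1 := ⟨hy.1, hy.2.trans hT.2.le⟩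
    rcases le_total x y with hxy | hxy
    · have := hm hx' hy' hxy
      have : 0 ≤ 1 / (1 - T) * |x - y| := by positivity
      linarith
    · have h1 := hf y hy' x hx' hxy
      have h2 := hm hy' hx' hxy
      rw [abs_of_nonneg (sub_nonneg.2 hxy), ← sub_le_iff_le_add', one_div_mul_eq_div,
        le_div_iff₀ hT1]
      refine le_trans ?_ h1
      exact mul_le_mul_of_nonneg_left (by linarith [hx.2]) (sub_nonneg.2 h2)
  exact this.absolutelyContinuousOnInterval

/-- The Lipschitz constants blow up at 1, so the endpoint is reached through continuity at 1 and the
integrability of the derivative of a monotone function. -/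
theorem ac_of_increment {f : ℝ → ℝ} (hm : MonotoneOn f (Icc (0 : ℝ) 1))
    (hf : ∀ s ∈ Icc (0 : ℝ) 1, ∀ t ∈ Icc (0 : ℝ) 1, s ≤ t → (f t - f s) * (1 - t) ≤ t - s)
    (hc : ContinuousWithinAt f (Icc (0 : ℝ) 1) 1) :
    AbsolutelyContinuousOnInterval f 0 1 := by
  refine AbsolutelyContinuousOnInterval.of_forall_lt one_pos ?_ ?_
    fun T hT => ac_of_increment_of_lt hm hf hT
  · intro t ht
    rcases eq_or_lt_of_le ht.2 with rfl | hlt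
    · exact hc
    · have hT : (t + 1) / 2 ∈ Ico (0 : ℝ) 1 := ⟨by linarith [ht.1], by linarith⟩
      have h1 := (ac_of_increment_of_lt hm hf hT).continuousOn
      rw [uIcc_of_le hT.1] at h1
      refine (h1 t ⟨ht.1, by linarith⟩).mono_of_mem_nhdsWithin ?_
      refine mem_nhdsWithin.2 ⟨Iio ((t + 1) / 2), isOpen_Iio, by simp; linarith, ?_⟩
      rintro x ⟨hx1, hx2⟩
      exact ⟨hx2.1, le_of_lt hx1⟩
  · exact MonotoneOn.intervalIntegrable_deriv (by rwa [uIcc_of_le zero_le_one])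

/-- Subtracting (1 - p)(1 - q) = 1 - time at s and t gives (p_t - p_s)(1 - q_t) + (1 - p_s)(q_t -
q_s) = t - s. Both terms are nonnegative and 1 - q_t ≥ 1 - t. -/
theorem p_ac (h : ExceedSystem p q) (i : Fin n) : AbsolutelyContinuousOnInterval (p i) 0 1 := by
  refine ac_of_increment (h.p_mono i) (fun s hs t ht hst => ?_) (h.p_cont i)
  have h1 := h.one_sub_mul i hs
  have h2 := h.one_sub_mul i ht
  have h3 := h.q_mono i hs ht hst
  have h4 := h.p_mono i hs ht hst
  have h5 := h.one_sub_le_one_sub_q i ht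
  have h6 := (h.p_mem i s hs).2
  nlinarith [mul_nonneg (sub_nonneg.2 h6) (sub_nonneg.2 h3),
    mul_nonneg (sub_nonneg.2 h4) (sub_nonneg.2 h5)]

theorem q_ac (h : ExceedSystem p q) (i : Fin n) : AbsolutelyContinuousOnInterval (q i) 0 1 := by
  refine ac_of_increment (h.q_mono i) (fun s hs t ht hst => ?_) (h.q_cont i)
  have h1 := h.one_sub_mul i hs
  have h2 := h.one_sub_mul i ht
  have h3 := h.q_mono i hs ht hst
  have h4 := h.p_mono i hs ht hst
  have h5 := h.one_sub_le_one_sub_p i ht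
  have h6 := (h.q_mem i hs).2
  nlinarith [mul_nonneg (sub_nonneg.2 h6) (sub_nonneg.2 h4),
    mul_nonneg (sub_nonneg.2 h3) (sub_nonneg.2 h5)]

theorem g_ac (h : ExceedSystem p q) : AbsolutelyContinuousOnInterval (gFun Γ p q) 0 1 := by
  refine AbsolutelyContinuousOnInterval.add (AbsolutelyContinuousOnInterval.const_mul Γ
    (AbsolutelyContinuousOnInterval.sub (absolutelyContinuousOnInterval_sum _ fun i _ => ?_)
      (absolutelyContinuousOnInterval_id 0 1))) (absolutelyContinuousOnInterval_const 1 0 1)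
  exact ((absolutelyContinuousOnInterval_const 1 0 1).sub (h.q_ac i)).mul (h.p_ac i)

theorem one_sub_le_g (h : ExceedSystem p q) (hΓ : 0 ≤ Γ) {t : ℝ} (ht : t ∈ Icc (0 : ℝ) 1) :
    1 - Γ ≤ gFun Γ p q t := by
  have : 0 ≤ ∑ i, (1 - q i t) * p i t := Finset.sum_nonneg fun i _ =>
    mul_nonneg (sub_nonneg.2 (h.q_mem i ht).2) (h.p_mem i t ht).1
  unfold gFun
  nlinarith [mul_nonneg hΓ this, mul_nonneg hΓ (sub_nonneg.2 ht.2)]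

theorem g_pos (h : ExceedSystem p q) (hΓ : 0 ≤ Γ) (hΓ1 : Γ < 1) {t : ℝ}
    (ht : t ∈ Icc (0 : ℝ) 1) : 0 < gFun Γ p q t :=
  (sub_pos.2 hΓ1).trans_le (h.one_sub_le_g hΓ ht)

theorem g_zero (h : ExceedSystem p q) : gFun Γ p q 0 = 1 := by
  simp [gFun, h.p_zero]

/-- Almost everywhere all the functions `p i` and `q i` are differentiable. -/
theorem ae_differentiable (h : ExceedSystem p q) : ∀ᵐ t : ℝ, t ∈ Ioo (0 : ℝ) 1 →
    ∀ i, DifferentiableAt ℝ (p i) t ∧ DifferentiableAt ℝ (q i) t := by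
  have h1 : ∀ᵐ t : ℝ, ∀ i, t ∈ uIcc (0 : ℝ) 1 → DifferentiableAt ℝ (p i) t :=
    ae_all_iff.2 fun i => (h.p_ac i).ae_differentiableAt
  have h2 : ∀ᵐ t : ℝ, ∀ i, t ∈ uIcc (0 : ℝ) 1 → DifferentiableAt ℝ (q i) t :=
    ae_all_iff.2 fun i => (h.q_ac i).ae_differentiableAt
  filter_upwards [h1, h2] with t h1 h2 ht i
  have : t ∈ uIcc (0 : ℝ) 1 := by
    rw [uIcc_of_le zero_le_one]
    exact Ioo_subset_Icc_self ht
  exact ⟨h1 i this, h2 i this⟩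

/-- This is the derivative of ∏ (1 - p_j) = 1 - t, with 1 - q_i as the product of the other factors.
-/
theorem sum_deriv_p (h : ExceedSystem p q) {t : ℝ} (ht : t ∈ Ioo (0 : ℝ) 1)
    (hd : ∀ i, DifferentiableAt ℝ (p i) t) : ∑ i, (1 - q i t) * deriv (p i) t = 1 := by
  have h1 : HasDerivAt (fun s => ∏ j, (1 - p j s))
      (∑ i, (∏ j ∈ Finset.univ.erase i, (1 - p j t)) • (-deriv (p i) t)) t :=
    HasDerivAt.fun_finsetProd fun i _ => by
      simpa using (hd i).hasDerivAt.const_sub 1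
  have h2 : HasDerivAt (fun s : ℝ => 1 - s) (-1) t := by
    simpa using (hasDerivAt_id t).const_sub 1
  have h3 : (fun s => ∏ j, (1 - p j s)) =ᶠ[𝓝 t] fun s => 1 - s := by
    filter_upwards [Ioo_mem_nhds ht.1 ht.2] with s hs
    exact h.prod_eq s (Ioo_subset_Icc_self hs)
  have h4 := (h2.congr_of_eventuallyEq h3).unique h1
  rw [← neg_inj, h4, ← Finset.sum_neg_distrib]
  refine Finset.sum_congr rfl fun i _ => ?_
  rw [h.q_eq i t (Ioo_subset_Icc_self ht)]
  simp

/-- In the product rule for Σ (1 - q_i) p_i, the terms with p_i' add up to 1 and cancel the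
derivative of t. -/
theorem ae_hasDerivAt_g (h : ExceedSystem p q) : ∀ᵐ t : ℝ, t ∈ Ioo (0 : ℝ) 1 →
    HasDerivAt (gFun Γ p q) (-Γ * ∑ i, deriv (q i) t * p i t) t := by
  filter_upwards [h.ae_differentiable] with t hd ht
  have h1 : HasDerivAt (fun s => ∑ i, (1 - q i s) * p i s)
      (∑ i, (-deriv (q i) t * p i t + (1 - q i t) * deriv (p i) t)) t :=
    HasDerivAt.fun_sum fun i _ =>
      (((hd ht i).2.hasDerivAt).const_sub 1).mul (hd ht i).1.hasDerivAt
  have h2 := ((h1.sub (hasDerivAt_id t)).const_mul Γ).add_const 1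
  convert! h2 using 1
  rw [Finset.sum_add_distrib, h.sum_deriv_p ht fun i => (hd ht i).1]
  simp

theorem deriv_q_nonneg (h : ExceedSystem p q) (i : Fin n) {t : ℝ} (ht : t ∈ Ico (0 : ℝ) 1) :
    0 ≤ deriv (q i) t := by
  rcases eq_or_lt_of_le ht.1 with rfl | h0
  -- At 0 the derivative is two-sided, so monotonicity on [0, 1] says nothing. Since q_i(0) = 0 and
  -- q_i ≥ 0 on the whole line, 0 is a minimum.
  · have : IsLocalMin (q i) 0 := by
      refine Eventually.of_forall fun s => ?_
      rw [h.q_zero i]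
      exact h.q_nonneg i s
    rw [this.deriv_eq_zero]
  · by_cases hd : DifferentiableAt ℝ (q i) t
    · rw [← hd.derivWithin (s := Icc (0 : ℝ) 1)
        ((uniqueDiffOn_Icc one_pos) t ⟨ht.1, ht.2.le⟩)]
      exact (h.q_mono i).derivWithin_nonneg
    · rw [deriv_zero_of_not_differentiableAt hd]

theorem intervalIntegrable_mul (h : ExceedSystem p q) (i : Fin n) {w : ℝ → ℝ}
    (hw : ContinuousOn w (Icc (0 : ℝ) 1)) {a b : ℝ} (ha : a ∈ Icc (0 : ℝ) 1)
    (hb : b ∈ Icc (0 : ℝ) 1) :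
    IntervalIntegrable (fun s => deriv (q i) s * w s) volume a b := by
  have h1 : IntervalIntegrable (fun s => deriv (q i) s * w s) volume 0 1 :=
    (h.q_ac i).intervalIntegrable_deriv.mul_continuousOn (by rwa [uIcc_of_le zero_le_one])
  refine h1.mono_set ?_
  rw [uIcc_of_le zero_le_one]
  exact uIcc_subset_Icc ha hb

theorem p_continuousOn (h : ExceedSystem p q) (i : Fin n) :
    ContinuousOn (p i) (Icc (0 : ℝ) 1) := by
  simpa [uIcc_of_le] using (h.p_ac i).continuousOn

theorem g_continuousOn (h : ExceedSystem p q) : ContinuousOn (gFun Γ p q) (Icc (0 : ℝ) 1) := by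
  simpa [uIcc_of_le] using (h.g_ac (Γ := Γ)).continuousOn

theorem intervalIntegrable_hazard (h : ExceedSystem p q) (hΓ : 0 ≤ Γ) (hΓ1 : Γ < 1) (i : Fin n)
    {a b : ℝ} (ha : a ∈ Icc (0 : ℝ) 1) (hb : b ∈ Icc (0 : ℝ) 1) :
    IntervalIntegrable (fun s => deriv (q i) s * p i s / gFun Γ p q s) volume a b := by
  simp only [mul_div_assoc]
  exact h.intervalIntegrable_mul i ((h.p_continuousOn i).div h.g_continuousOn
    fun t ht => (h.g_pos hΓ hΓ1 ht).ne') ha hb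

theorem exp_comp_ac {f : ℝ → ℝ} {a b : ℝ} (hf : AbsolutelyContinuousOnInterval f a b) :
    AbsolutelyContinuousOnInterval (fun t => Real.exp (f t)) a b := by
  have hK : IsCompact (f '' uIcc a b) := isCompact_uIcc.image_of_continuousOn hf.continuousOn
  obtain ⟨M, hM⟩ := hK.isBounded.subset_closedBall 0
  obtain ⟨K, hKL⟩ := (Real.contDiff_exp (n := 1)).contDiffOn.exists_lipschitzOnWith
    (s := Metric.closedBall (0 : ℝ) M) (by simp) (convex_closedBall _ _) (isCompact_closedBall _ _)
  exact AbsolutelyContinuousOnInterval.comp_lipschitzOnWith hf (hKL.mono hM)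

theorem surv_ac (h : ExceedSystem p q) (hΓ : 0 ≤ Γ) (hΓ1 : Γ < 1) (i : Fin n) :
    AbsolutelyContinuousOnInterval (surv Γ p q i) 0 1 :=
  exp_comp_ac (AbsolutelyContinuousOnInterval.const_mul _
    ((h.intervalIntegrable_hazard hΓ hΓ1 i (by simp)
      (by simp)).absolutelyContinuousOnInterval_intervalIntegral (by simp)))

theorem surv_continuousOn (h : ExceedSystem p q) (hΓ : 0 ≤ Γ) (hΓ1 : Γ < 1) (i : Fin n) :
    ContinuousOn (surv Γ p q i) (Icc (0 : ℝ) 1) := by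
  simpa [uIcc_of_le] using (h.surv_ac hΓ hΓ1 i).continuousOn

theorem surv_zero (i : Fin n) : surv Γ p q i 0 = 1 := by simp [surv]

theorem ae_hasDerivAt_surv (h : ExceedSystem p q) (hΓ : 0 ≤ Γ) (hΓ1 : Γ < 1) (i : Fin n) :
    ∀ᵐ t : ℝ, t ∈ Ioo (0 : ℝ) 1 →
      HasDerivAt (surv Γ p q i) (-(dens Γ p q i t * p i t)) t := by
  filter_upwards [(h.intervalIntegrable_hazard hΓ hΓ1 i (a := 0) (b := 1) (by simp)
      (by simp)).ae_hasDerivAt_integral] with t hd ht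
  have h1 := hd (by rw [uIcc_of_le zero_le_one]; exact Ioo_subset_Icc_self ht) 0 (by simp)
  have h2 := (h1.const_mul (-Γ)).exp
  convert! h2 using 1
  simp only [dens, surv]
  ring

/-- The survival probabilities multiply to `g`. -/
theorem prod_surv (h : ExceedSystem p q) (hΓ : 0 ≤ Γ) (hΓ1 : Γ < 1) {t : ℝ}
    (ht : t ∈ Icc (0 : ℝ) 1) : ∏ i, surv Γ p q i t = gFun Γ p q t := by
  -- The product of the S_i is exp(-W). The function g exp(W) has derivative zero almost everywhere
  -- and equals 1 at 0.
  set W : ℝ → ℝ := fun t => ∑ i, Γ * ∫ s in (0 : ℝ)..t, deriv (q i) s * p i s / gFun Γ p q s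
  have hW : AbsolutelyContinuousOnInterval W 0 1 :=
    absolutelyContinuousOnInterval_sum _ fun i _ => AbsolutelyContinuousOnInterval.const_mul _
      ((h.intervalIntegrable_hazard hΓ hΓ1 i (by simp)
        (by simp)).absolutelyContinuousOnInterval_intervalIntegral (by simp))
  have hF : AbsolutelyContinuousOnInterval (fun t => gFun Γ p q t * Real.exp (W t)) 0 1 :=
    h.g_ac.mul (exp_comp_ac hW)
  have hdW : ∀ᵐ t : ℝ, ∀ i, t ∈ Ioo (0 : ℝ) 1 →
      HasDerivAt (fun t => ∫ s in (0 : ℝ)..t, deriv (q i) s * p i s / gFun Γ p q s)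
        (deriv (q i) t * p i t / gFun Γ p q t) t := by
    refine ae_all_iff.2 fun i => ?_
    filter_upwards [(h.intervalIntegrable_hazard hΓ hΓ1 i (a := 0) (b := 1) (by simp)
      (by simp)).ae_hasDerivAt_integral] with t hd ht
    exact hd (by rw [uIcc_of_le zero_le_one]; exact Ioo_subset_Icc_self ht) 0 (by simp)
  have hd : ∀ᵐ s : ℝ, s ∈ Ioo (0 : ℝ) t →
      HasDerivAt (fun t => gFun Γ p q t * Real.exp (W t)) ((fun _ => 0) s) s := by
    filter_upwards [hdW, h.ae_hasDerivAt_g (Γ := Γ)] with s h1 h2 hs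
    have hs' : s ∈ Ioo (0 : ℝ) 1 := ⟨hs.1, hs.2.trans_le ht.2⟩
    have h3 : HasDerivAt W (∑ i, Γ * (deriv (q i) s * p i s / gFun Γ p q s)) s :=
      HasDerivAt.fun_sum fun i _ => (h1 i hs').const_mul Γ
    have h4 := (h2 hs').mul h3.exp
    convert! h4 using 1
    have hg := (h.g_pos hΓ hΓ1 (Ioo_subset_Icc_self hs')).ne'
    rw [← Finset.mul_sum, ← Finset.sum_div]
    field_simp
    ring
  have hF' : AbsolutelyContinuousOnInterval (fun t => gFun Γ p q t * Real.exp (W t)) 0 t :=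
    hF.mono (by rw [uIcc_of_le ht.1, uIcc_of_le zero_le_one]; exact Icc_subset_Icc_right ht.2)
  have key := AbsolutelyContinuousOnInterval.integral_eq_sub_of_ae_hasDerivAt ht.1 hF' hd
  have hW0 : W 0 = 0 := by simp [W]
  simp only [intervalIntegral.integral_zero, h.g_zero, hW0, Real.exp_zero, mul_one] at key
  have h5 : ∏ i, surv Γ p q i t = Real.exp (-W t) := by
    simp only [surv, W, ← Real.exp_sum, ← Finset.sum_neg_distrib, neg_mul]
  rw [h5, Real.exp_neg, inv_eq_one_div, div_eq_iff (Real.exp_pos _).ne']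
  linarith

theorem integral_dens_mul_p (h : ExceedSystem p q) (hΓ : 0 ≤ Γ) (hΓ1 : Γ < 1) (i : Fin n)
    {t : ℝ} (ht : t ∈ Icc (0 : ℝ) 1) :
    ∫ s in (0 : ℝ)..t, dens Γ p q i s * p i s = 1 - surv Γ p q i t := by
  have hS : AbsolutelyContinuousOnInterval (surv Γ p q i) 0 t := (h.surv_ac hΓ hΓ1 i).mono
    (by rw [uIcc_of_le ht.1, uIcc_of_le zero_le_one]; exact Icc_subset_Icc_right ht.2)
  have := AbsolutelyContinuousOnInterval.integral_eq_sub_of_ae_hasDerivAt ht.1 hS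
    ((h.ae_hasDerivAt_surv hΓ hΓ1 i).mono fun s hs hs' => hs ⟨hs'.1, hs'.2.trans_le ht.2⟩)
  rw [intervalIntegral.integral_neg, surv_zero] at this
  linarith

theorem dens_nonneg (h : ExceedSystem p q) (hΓ : 0 ≤ Γ) (hΓ1 : Γ < 1) (i : Fin n) {t : ℝ}
    (ht : t ∈ Ico (0 : ℝ) 1) : 0 ≤ dens Γ p q i t :=
  mul_nonneg (mul_nonneg hΓ (div_nonneg (h.deriv_q_nonneg i ht)
    (h.g_pos hΓ hΓ1 (Ico_subset_Icc_self ht)).le)) (surv_pos _ _ _ _ _).le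

theorem dens_intervalIntegrable (h : ExceedSystem p q) (hΓ : 0 ≤ Γ) (hΓ1 : Γ < 1) (i : Fin n)
    {a b : ℝ} (ha : a ∈ Icc (0 : ℝ) 1) (hb : b ∈ Icc (0 : ℝ) 1) :
    IntervalIntegrable (dens Γ p q i) volume a b := by
  have := (h.intervalIntegrable_mul i ((h.surv_continuousOn hΓ hΓ1 i).div h.g_continuousOn
    fun t ht => (h.g_pos hΓ hΓ1 ht).ne') ha hb).const_mul Γ
  refine this.congr fun t _ => ?_
  simp only [dens, Pi.div_apply]
  ring

/-- The factor S_i in the density completes the product to ∏ S_j = g, which cancels the denominator.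
This is the reason for the form of f_i. -/
theorem dens_mul_prod_surv (h : ExceedSystem p q) (hΓ : 0 ≤ Γ) (hΓ1 : Γ < 1) (i : Fin n)
    {t : ℝ} (ht : t ∈ Icc (0 : ℝ) 1) :
    dens Γ p q i t * ∏ j ∈ Finset.univ.erase i, surv Γ p q j t = Γ * deriv (q i) t := by
  have hg := (h.g_pos hΓ hΓ1 ht).ne'
  have h1 := h.prod_surv hΓ hΓ1 ht
  rw [← Finset.mul_prod_erase _ _ (Finset.mem_univ i)] at h1
  rw [dens, mul_assoc, h1]
  field_simp

theorem sum_integral_deriv_mul (h : ExceedSystem p q) {t : ℝ} (ht : t ∈ Icc (0 : ℝ) 1) :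
    Γ * ∑ i, ∫ s in (0 : ℝ)..t, deriv (q i) s * p i s = 1 - gFun Γ p q t := by
  have hG : AbsolutelyContinuousOnInterval (gFun Γ p q) 0 t := h.g_ac.mono
    (by rw [uIcc_of_le ht.1, uIcc_of_le zero_le_one]; exact Icc_subset_Icc_right ht.2)
  have := AbsolutelyContinuousOnInterval.integral_eq_sub_of_ae_hasDerivAt ht.1 hG
    ((h.ae_hasDerivAt_g).mono fun s hs hs' => hs ⟨hs'.1, hs'.2.trans_le ht.2⟩)
  rw [intervalIntegral.integral_const_mul, intervalIntegral.integral_finsetSum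
    fun i _ => h.intervalIntegrable_mul i (h.p_continuousOn i) (by simp) ht, h.g_zero] at this
  linarith

end ExceedSystem

/-! ### The barrier inequality for the arrival densities. -/

/-- A lower barrier for the ratio between the probability that an item has not arrived and the
probability that it has not been acceptable, as a function of `x = 1 - q i t`. -/
structure IsBarrier (Γ : ℝ) (B b : ℝ → ℝ) : Prop where
  at_one : B 1 = 1
  hasDerivAt : ∀ x, HasDerivAt B (b x) x
  continuous_deriv : Continuous b
  le_one : ∀ x ∈ Icc (0 : ℝ) 1, B x ≤ 1
  deriv_ge : ∀ x ∈ Icc (0 : ℝ) 1, ∀ P ∈ Icc (0 : ℝ) 1,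
    Γ * (1 - B x * P) ≤ b x * (1 - Γ + Γ * (x - (1 - P) * (x * Real.log x)))
  ge : ∀ x ∈ Icc (0 : ℝ) 1, Γ * x ≤ B x * (1 - Γ + Γ * x)

theorem IsBarrier.comp_ac {Γ : ℝ} {B b f : ℝ → ℝ} {u v : ℝ} (hB : IsBarrier Γ B b)
    (hf : AbsolutelyContinuousOnInterval f u v) :
    AbsolutelyContinuousOnInterval (fun t => B (f t)) u v := by
  have hK : IsCompact (f '' uIcc u v) := isCompact_uIcc.image_of_continuousOn hf.continuousOn
  obtain ⟨M, hM⟩ := hK.isBounded.subset_closedBall 0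
  have hdB : deriv B = b := funext fun x => (hB.hasDerivAt x).deriv
  have hC : ContDiff ℝ 1 B := by
    rw [contDiff_one_iff_deriv, hdB]
    exact ⟨fun x => (hB.hasDerivAt x).differentiableAt, hB.continuous_deriv⟩
  obtain ⟨K, hKL⟩ := hC.contDiffOn.exists_lipschitzOnWith
    (s := Metric.closedBall (0 : ℝ) M) (by simp) (convex_closedBall _ _) (isCompact_closedBall _ _)
  exact AbsolutelyContinuousOnInterval.comp_lipschitzOnWith hf (hKL.mono hM)

/-- The probability that exactly one of several independent events occurs is at least
`-x log x`, where `x` is the probability that none occurs. -/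
theorem neg_mul_log_prod_le {ι : Type*} [DecidableEq ι] (s : Finset ι) (a : ι → ℝ)
    (h0 : ∀ j ∈ s, 0 ≤ a j) (h1 : ∀ j ∈ s, a j ≤ 1) :
    -((∏ j ∈ s, (1 - a j)) * Real.log (∏ j ∈ s, (1 - a j))) ≤
      ∑ j ∈ s, a j * ∏ k ∈ s.erase j, (1 - a k) := by
  have hnn : ∀ j ∈ s, 0 ≤ a j * ∏ k ∈ s.erase j, (1 - a k) := fun j hj =>
    mul_nonneg (h0 j hj) (Finset.prod_nonneg fun k hk => sub_nonneg.2
      (h1 k (Finset.mem_of_mem_erase hk)))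
  by_cases hz : ∏ j ∈ s, (1 - a j) = 0
  · rw [hz]
    simpa using Finset.sum_nonneg hnn
  · have hne : ∀ j ∈ s, 1 - a j ≠ 0 := Finset.prod_ne_zero_iff.1 hz
    have hpos : ∀ j ∈ s, 0 < 1 - a j := fun j hj =>
      lt_of_le_of_ne (sub_nonneg.2 (h1 j hj)) (hne j hj).symm
    rw [Real.log_prod hne, Finset.mul_sum, ← Finset.sum_neg_distrib]
    refine Finset.sum_le_sum fun j hj => ?_
    rw [← Finset.mul_prod_erase s (fun j => 1 - a j) hj]
    have hlog := Real.one_sub_inv_le_log_of_pos (hpos j hj)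
    have hP : 0 ≤ ∏ k ∈ s.erase j, (1 - a k) := Finset.prod_nonneg fun k hk =>
      (hpos k (Finset.mem_of_mem_erase hk)).le
    -- After log ∏ = Σ log the bound is termwise; this is 1 - 1/u ≤ log u at u = 1 - a_j, times u.
    have h2 : -((1 - a j) * Real.log (1 - a j)) ≤ a j := by
      have := mul_le_mul_of_nonneg_left hlog (hpos j hj).le
      rw [mul_sub, mul_inv_cancel₀ (hne j hj)] at this
      linarith
    nlinarith [mul_le_mul_of_nonneg_right h2 hP]

namespace ExceedSystem

variable {n : ℕ} {p q : Fin n → ℝ → ℝ} {Γ : ℝ}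

/-- Σ (1 - q_j) p_j is the probability that exactly one value exceeds the threshold. Either it is
item i alone, or item i stays below and exactly one of the others exceeds; `neg_mul_log_prod_le`
bounds the latter with x = 1 - q_i. Finally t = 1 - (1 - p_i) x. -/
theorem g_ge (h : ExceedSystem p q) (hΓ : 0 ≤ Γ) (i : Fin n) {t : ℝ} (ht : t ∈ Icc (0 : ℝ) 1) :
    1 - Γ + Γ * ((1 - q i t) - (1 - p i t) * ((1 - q i t) * Real.log (1 - q i t))) ≤
      gFun Γ p q t := by
  have h1 := neg_mul_log_prod_le (Finset.univ.erase i) (fun j => p j t)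
    (fun j _ => (h.p_mem j t ht).1) (fun j _ => (h.p_mem j t ht).2)
  rw [← h.q_eq i t ht] at h1
  have h2 : ∑ j, (1 - q j t) * p j t = (1 - q i t) * p i t + (1 - p i t) *
      ∑ j ∈ Finset.univ.erase i, p j t * ∏ k ∈ (Finset.univ.erase i).erase j, (1 - p k t) := by
    rw [← Finset.add_sum_erase _ _ (Finset.mem_univ i), Finset.mul_sum]
    congr 1
    refine Finset.sum_congr rfl fun j hj => ?_
    have hij : i ∈ Finset.univ.erase j := by
      simpa using (Finset.ne_of_mem_erase hj).symm
    rw [h.q_eq j t ht, ← Finset.mul_prod_erase _ _ hij, Finset.erase_right_comm]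
    ring
  have h3 := h.one_sub_mul i ht
  have h4 := mul_le_mul_of_nonneg_left h1 (sub_nonneg.2 (h.p_mem i t ht).2)
  have h5 : (1 - q i t) - (1 - p i t) * ((1 - q i t) * Real.log (1 - q i t)) - 1 ≤
      (∑ j, (1 - q j t) * p j t) - t := by
    rw [h2]
    nlinarith
  unfold gFun
  nlinarith [mul_le_mul_of_nonneg_left h5 hΓ]

/-- The difference 1 - ∫₀ᵗ f_i - B(1 - q_i) S_i vanishes at 0. Its derivative is q_i' S_i (b - Γ(1 -
B p_i) / g), which is nonnegative by `deriv_ge` and `g_ge`. -/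
theorem barrier_le (h : ExceedSystem p q) (hΓ : 0 ≤ Γ) (hΓ1 : Γ < 1) {B b : ℝ → ℝ}
    (hB : IsBarrier Γ B b) (i : Fin n) :
    B (1 - q i 1) * surv Γ p q i 1 ≤ 1 - ∫ s in (0 : ℝ)..1, dens Γ p q i s := by
  have hq : AbsolutelyContinuousOnInterval (fun t => B (1 - q i t)) 0 1 :=
    hB.comp_ac ((absolutelyContinuousOnInterval_const 1 0 1).sub (h.q_ac i))
  have hF : AbsolutelyContinuousOnInterval (fun t => (1 - ∫ s in (0 : ℝ)..t, dens Γ p q i s)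
      - B (1 - q i t) * surv Γ p q i t) 0 1 :=
    ((absolutelyContinuousOnInterval_const 1 0 1).sub
      ((h.dens_intervalIntegrable hΓ hΓ1 i (by simp)
        (by simp)).absolutelyContinuousOnInterval_intervalIntegral (by simp))).sub
      (hq.mul (h.surv_ac hΓ hΓ1 i))
  have hd : ∀ᵐ t : ℝ, t ∈ Ioo (0 : ℝ) 1 → HasDerivAt (fun t =>
      (1 - ∫ s in (0 : ℝ)..t, dens Γ p q i s) - B (1 - q i t) * surv Γ p q i t)
      (-dens Γ p q i t - (b (1 - q i t) * (-deriv (q i) t) * surv Γ p q i t +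
        B (1 - q i t) * -(dens Γ p q i t * p i t))) t := by
    filter_upwards [(h.dens_intervalIntegrable hΓ hΓ1 i (a := 0) (b := 1) (by simp)
      (by simp)).ae_hasDerivAt_integral, h.ae_hasDerivAt_surv hΓ hΓ1 i, h.ae_differentiable]
      with t h1 h2 h3 ht
    have h1' := h1 (by rw [uIcc_of_le zero_le_one]; exact Ioo_subset_Icc_self ht) 0 (by simp)
    have h4 : HasDerivAt (fun t => B (1 - q i t)) (b (1 - q i t) * (-deriv (q i) t)) t :=
      (hB.hasDerivAt _).comp t (((h3 ht i).2.hasDerivAt).const_sub 1)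
    exact (h1'.const_sub 1).sub (h4.mul (h2 ht))
  have key := AbsolutelyContinuousOnInterval.le_of_ae_hasDerivAt_nonneg zero_le_one hF hd
    (Eventually.of_forall fun t ht => ?_)
  · simp only [intervalIntegral.integral_same, h.q_zero, sub_zero, hB.at_one, surv_zero] at key
    linarith
  · have ht' := Ioo_subset_Icc_self ht
    have hg := h.g_pos hΓ hΓ1 ht'
    have hqm := h.q_mem i ht'
    have hpm := h.p_mem i t ht'
    have hx : 1 - q i t ∈ Icc (0 : ℝ) 1 := ⟨by linarith [hqm.2], by linarith [hqm.1]⟩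
    have h1 := hB.deriv_ge _ hx _ hpm
    have h2 := h.g_ge hΓ i ht'
    have hBp : 0 ≤ 1 - B (1 - q i t) * p i t := by
      nlinarith [hB.le_one _ hx, hpm.1, hpm.2]
    have hG : 0 < 1 - Γ + Γ * ((1 - q i t) -
        (1 - p i t) * ((1 - q i t) * Real.log (1 - q i t))) := by
      have hl : (1 - q i t) * Real.log (1 - q i t) ≤ 0 := Real.mul_log_nonpos hx.1 hx.2
      have : 0 ≤ (1 - q i t) - (1 - p i t) * ((1 - q i t) * Real.log (1 - q i t)) := by
        nlinarith [hpm.2, hx.1, mul_nonneg (sub_nonneg.2 hpm.2) (neg_nonneg.2 hl)]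
      nlinarith [mul_nonneg hΓ this]
    -- The sign of b is needed to replace the lower bound of `g_ge` by g itself in `deriv_ge`.
    have hb : 0 ≤ b (1 - q i t) := by
      by_contra hneg
      have := mul_neg_of_neg_of_pos (not_le.1 hneg) hG
      linarith [mul_nonneg hΓ hBp]
    have h3 : Γ * (1 - B (1 - q i t) * p i t) / gFun Γ p q t ≤ b (1 - q i t) := by
      rw [div_le_iff₀ hg]
      exact h1.trans (mul_le_mul_of_nonneg_left h2 hb)
    have h4 : 0 ≤ deriv (q i) t * surv Γ p q i t *
        (b (1 - q i t) - Γ * (1 - B (1 - q i t) * p i t) / gFun Γ p q t) :=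
      mul_nonneg (mul_nonneg (h.deriv_q_nonneg i (Ioo_subset_Ico_self ht))
        (surv_pos _ _ _ _ _).le) (sub_nonneg.2 h3)
    refine h4.trans_eq ?_
    unfold dens
    ring

/-- The arrival density has total mass at most one. -/
theorem integral_dens_le_one (h : ExceedSystem p q) (hΓ : 0 ≤ Γ) (hΓ1 : Γ < 1) {B b : ℝ → ℝ}
    (hB : IsBarrier Γ B b) (i : Fin n) : ∫ s in (0 : ℝ)..1, dens Γ p q i s ≤ 1 := by
  have h1 := h.barrier_le hΓ hΓ1 hB i
  have hqm := h.q_mem i (t := 1) (by simp)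
  have hx : 1 - q i 1 ∈ Icc (0 : ℝ) 1 := ⟨by linarith [hqm.2], by linarith [hqm.1]⟩
  have h2 : 0 ≤ B (1 - q i 1) := by
    by_contra hneg
    have hpos : 0 < 1 - Γ + Γ * (1 - q i 1) := by nlinarith [mul_nonneg hΓ hx.1]
    have := mul_neg_of_neg_of_pos (not_le.1 hneg) hpos
    linarith [hB.ge _ hx, mul_nonneg hΓ hx.1]
  linarith [mul_nonneg h2 (surv_pos Γ p q i 1).le]

/-- The total acceptance probability above the threshold of time `t`. -/
theorem le_total (h : ExceedSystem p q) (hΓ : 0 ≤ Γ) (hΓ1 : Γ < 1) {B b : ℝ → ℝ}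
    (hB : IsBarrier Γ B b) {i₁ : Fin n} (hi : p i₁ 1 = 1) {t : ℝ} (ht : t ∈ Icc (0 : ℝ) 1) :
    Γ * t ≤ (∑ i, Γ * ((∫ s in (0 : ℝ)..t, deriv (q i) s * p i s) +
        (q i 1 - q i t) * p i t)) +
      (1 - ∫ s in (0 : ℝ)..1, dens Γ p q i₁ s) *
        (∏ j ∈ Finset.univ.erase i₁, surv Γ p q j 1) * p i₁ t := by
  have h1m : (1 : ℝ) ∈ Icc (0 : ℝ) 1 := by simp
  -- Item i₁ exceeds τ(1) almost surely and is one of the competitors of every other item, so only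
  -- i₁ can have q(1) < 1.
  have hq1 : ∀ j, j ≠ i₁ → 1 - q j 1 = 0 := fun j hj => by
    rw [h.q_eq j 1 h1m]
    exact Finset.prod_eq_zero (i := i₁) (by simpa using hj.symm) (by simp [hi])
  have hsum : ∀ w : Fin n → ℝ, ∑ i, (1 - q i 1) * w i = (1 - q i₁ 1) * w i₁ := fun w =>
    Finset.sum_eq_single i₁ (fun j _ hj => by rw [hq1 j hj, zero_mul]) (by simp)
  have hg1 : gFun Γ p q 1 = 1 - Γ + Γ * (1 - q i₁ 1) := by
    rw [gFun, hsum fun i => p i 1, hi]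
    ring
  have hqm := h.q_mem i₁ h1m
  have hx : 1 - q i₁ 1 ∈ Icc (0 : ℝ) 1 := ⟨by linarith [hqm.2], by linarith [hqm.1]⟩
  have hprod := h.prod_surv hΓ hΓ1 h1m
  rw [← Finset.mul_prod_erase _ _ (Finset.mem_univ i₁)] at hprod
  have hP : 0 ≤ ∏ j ∈ Finset.univ.erase i₁, surv Γ p q j 1 :=
    Finset.prod_nonneg fun j _ => (surv_pos _ _ _ _ _).le
  have h2 : Γ * (1 - q i₁ 1) ≤ (1 - ∫ s in (0 : ℝ)..1, dens Γ p q i₁ s) *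
      ∏ j ∈ Finset.univ.erase i₁, surv Γ p q j 1 := by
    -- Multiplying `barrier_le` by the other survival probabilities completes ∏ S_j(1) = g(1) = 1 -
    -- Γ + Γ x at x = 1 - q_{i₁}(1). What is left is the field `ge` of the barrier.
    refine le_trans ?_ (mul_le_mul_of_nonneg_right (h.barrier_le hΓ hΓ1 hB i₁) hP)
    rw [mul_assoc, hprod, hg1]
    exact hB.ge _ hx
  have h3 : ∑ i, Γ * ((∫ s in (0 : ℝ)..t, deriv (q i) s * p i s) + (q i 1 - q i t) * p i t) =
      Γ * t - Γ * (1 - q i₁ 1) * p i₁ t := by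
    have h4 := h.sum_integral_deriv_mul (Γ := Γ) ht
    have h5 : ∑ i, (q i 1 - q i t) * p i t =
        ∑ i, (1 - q i t) * p i t - ∑ i, (1 - q i 1) * p i t := by
      rw [← Finset.sum_sub_distrib]
      exact Finset.sum_congr rfl fun i _ => by ring
    rw [← Finset.mul_sum, Finset.sum_add_distrib, mul_add, h4, h5, hsum fun i => p i t, gFun]
    ring
  rw [h3]
  nlinarith [mul_le_mul_of_nonneg_right h2 (h.p_mem i₁ t ht).1]

end ExceedSystem

/-! ### Construction of the barrier from α and Γ. -/

section Barrier

variable {Γ α : ℝ}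

/-- The lower bound for `g` when `p = 0`, as a function of `x = 1 - q`. -/
noncomputable def lowG (Γ x : ℝ) : ℝ := 1 - Γ + Γ * (x - x * Real.log x)

/-- The point of `[0, 1]` nearest to `x`. -/
noncomputable def clampUnit (x : ℝ) : ℝ := max 0 (min x 1)

/-- The derivative of the barrier, extended continuously to the real line. -/
noncomputable def barrierDeriv (Γ α x : ℝ) : ℝ :=
  if clampUnit x ≤ α then Γ * (1 - Γ) / (1 - Γ + Γ * clampUnit x) ^ 2
  else Γ / lowG Γ (clampUnit x)

/-- The barrier. -/
noncomputable def barrier (Γ α x : ℝ) : ℝ := 1 + ∫ y in (1 : ℝ)..x, barrierDeriv Γ α y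

theorem clampUnit_mem (x : ℝ) : clampUnit x ∈ Icc (0 : ℝ) 1 :=
  ⟨le_max_left _ _, max_le zero_le_one (min_le_right _ _)⟩

theorem clampUnit_of_mem {x : ℝ} (hx : x ∈ Icc (0 : ℝ) 1) : clampUnit x = x := by
  rw [clampUnit, min_eq_left hx.2, max_eq_right hx.1]

theorem continuous_clampUnit : Continuous clampUnit := by
  unfold clampUnit
  fun_prop

theorem affine_pos (h0 : 0 < Γ) (h1 : Γ < 1) {x : ℝ} (hx : 0 ≤ x) : 0 < 1 - Γ + Γ * x := by
  nlinarith [mul_nonneg h0.le hx]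

theorem affine_le_lowG (h0 : 0 < Γ) {x : ℝ} (hx : x ∈ Icc (0 : ℝ) 1) :
    1 - Γ + Γ * x ≤ lowG Γ x := by
  have := Real.mul_log_nonpos hx.1 hx.2
  unfold lowG
  nlinarith [mul_nonneg h0.le (neg_nonneg.2 this)]

theorem lowG_pos (h0 : 0 < Γ) (h1 : Γ < 1) {x : ℝ} (hx : x ∈ Icc (0 : ℝ) 1) : 0 < lowG Γ x :=
  (affine_pos h0 h1 hx.1).trans_le (affine_le_lowG h0 hx)

theorem continuous_lowG : Continuous (lowG Γ) := by
  have := Real.continuous_mul_log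
  unfold lowG
  fun_prop

theorem affine_at (hrel : (1 - Γ) * (-Real.log α - 1) = Γ * α) :
    1 - Γ + Γ * α = (1 - Γ) * -Real.log α := by linarith

theorem lowG_at (hrel : (1 - Γ) * (-Real.log α - 1) = Γ * α) :
    lowG Γ α = (1 - Γ) * Real.log α ^ 2 := by
  have : lowG Γ α = 1 - Γ + (Γ * α) * (1 - Real.log α) := by unfold lowG; ring
  rw [this, ← hrel]
  ring

/-- This is the matching of the two derivatives at α: Γ(1 - Γ) / (1 - Γ + Γα)² = Γ / `lowG` Γ α. -/
theorem affine_sq_at (hrel : (1 - Γ) * (-Real.log α - 1) = Γ * α) :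
    (1 - Γ + Γ * α) ^ 2 = (1 - Γ) * lowG Γ α := by
  rw [lowG_at hrel, affine_at hrel]
  ring

theorem continuous_barrierDeriv (h0 : 0 < Γ) (h1 : Γ < 1) (hα : α ∈ Ioo (0 : ℝ) 1)
    (hrel : (1 - Γ) * (-Real.log α - 1) = Γ * α) : Continuous (barrierDeriv Γ α) := by
  refine Continuous.if_le ?_ ?_ continuous_clampUnit continuous_const fun x hx => ?_
  · refine continuous_const.div (by have := continuous_clampUnit; fun_prop) fun x => ?_
    exact (pow_pos (affine_pos h0 h1 (clampUnit_mem x).1) 2).ne'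
  · exact continuous_const.div (continuous_lowG.comp continuous_clampUnit)
      fun x => (lowG_pos h0 h1 (clampUnit_mem x)).ne'
  · have hα' : α ∈ Icc (0 : ℝ) 1 := Ioo_subset_Icc_self hα
    have := lowG_pos h0 h1 hα'
    rw [hx, affine_sq_at hrel]
    have h2 : 1 - Γ ≠ 0 := (sub_pos.2 h1).ne'
    field_simp

theorem barrierDeriv_of_le (hα : α ∈ Ioo (0 : ℝ) 1) {x : ℝ} (hx : x ∈ Icc 0 α) :
    barrierDeriv Γ α x = Γ * (1 - Γ) / (1 - Γ + Γ * x) ^ 2 := by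
  rw [barrierDeriv, clampUnit_of_mem ⟨hx.1, hx.2.trans hα.2.le⟩, if_pos hx.2]

theorem barrierDeriv_of_ge (h0 : 0 < Γ) (h1 : Γ < 1) (hα : α ∈ Ioo (0 : ℝ) 1)
    (hrel : (1 - Γ) * (-Real.log α - 1) = Γ * α) {x : ℝ} (hx : x ∈ Icc α 1) :
    barrierDeriv Γ α x = Γ / lowG Γ x := by
  have hx' : x ∈ Icc (0 : ℝ) 1 := ⟨hα.1.le.trans hx.1, hx.2⟩
  rw [barrierDeriv, clampUnit_of_mem hx']
  split_ifs with h
  · obtain rfl : x = α := le_antisymm h hx.1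
    have := lowG_pos h0 h1 hx'
    rw [affine_sq_at hrel]
    have h2 : 1 - Γ ≠ 0 := (sub_pos.2 h1).ne'
    field_simp
  · rfl

theorem hasDerivAt_barrier (hb : Continuous (barrierDeriv Γ α)) (x : ℝ) :
    HasDerivAt (barrier Γ α) (barrierDeriv Γ α x) x :=
  ((hb.integral_hasStrictDerivAt 1 x).hasDerivAt).const_add 1

theorem barrier_at (h0 : 0 < Γ) (h1 : Γ < 1) (hα : α ∈ Ioo (0 : ℝ) 1)
    (hrel : (1 - Γ) * (-Real.log α - 1) = Γ * α)
    (hint : ∫ x in α..1, Γ / lowG Γ x = -1 / Real.log α) :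
    barrier Γ α α = 1 + 1 / Real.log α := by
  rw [barrier, intervalIntegral.integral_symm, intervalIntegral.integral_congr
    (g := fun x => Γ / lowG Γ x), hint]
  · ring
  · intro x hx
    rw [uIcc_of_le hα.2.le] at hx
    exact barrierDeriv_of_ge h0 h1 hα hrel hx

theorem hasDerivAt_endRatio (h0 : 0 < Γ) (h1 : Γ < 1) {x : ℝ} (hx : 0 ≤ x) :
    HasDerivAt (fun y => Γ * y / (1 - Γ + Γ * y)) (Γ * (1 - Γ) / (1 - Γ + Γ * x) ^ 2) x := by
  have hA := affine_pos h0 h1 hx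
  have h2 : HasDerivAt (fun y : ℝ => Γ * y) Γ x := by
    simpa using (hasDerivAt_id x).const_mul Γ
  convert! h2.div (h2.const_add (1 - Γ)) hA.ne' using 1
  congr 1
  ring

theorem endRatio_at (h1 : Γ < 1) (hα : α ∈ Ioo (0 : ℝ) 1)
    (hrel : (1 - Γ) * (-Real.log α - 1) = Γ * α) :
    Γ * α / (1 - Γ + Γ * α) = 1 + 1 / Real.log α := by
  have hl := Real.log_neg hα.1 hα.2
  have h2 : 1 - Γ ≠ 0 := (sub_pos.2 h1).ne'
  rw [affine_at hrel, ← hrel]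
  have := hl.ne
  field_simp
  ring

/-- The two functions have the same derivative on [0, α], and the integral equation makes both equal
1 + 1 / log α at α. -/
theorem barrier_of_le (h0 : 0 < Γ) (h1 : Γ < 1) (hα : α ∈ Ioo (0 : ℝ) 1)
    (hrel : (1 - Γ) * (-Real.log α - 1) = Γ * α)
    (hint : ∫ x in α..1, Γ / lowG Γ x = -1 / Real.log α) {x : ℝ} (hx : x ∈ Icc 0 α) :
    barrier Γ α x = Γ * x / (1 - Γ + Γ * x) := by
  have hb := continuous_barrierDeriv h0 h1 hα hrel
  have e1 := intervalIntegral.integral_eq_sub_of_hasDerivAt (a := x) (b := α)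
    (fun y _ => hasDerivAt_barrier hb y) (hb.intervalIntegrable _ _)
  have e2 := intervalIntegral.integral_eq_sub_of_hasDerivAt (a := x) (b := α)
    (f := fun y => Γ * y / (1 - Γ + Γ * y)) (f' := barrierDeriv Γ α)
    (fun y hy => by
      rw [uIcc_of_le hx.2] at hy
      have hy' : y ∈ Icc 0 α := ⟨hx.1.trans hy.1, hy.2⟩
      rw [barrierDeriv_of_le hα hy']
      exact hasDerivAt_endRatio h0 h1 hy'.1) (hb.intervalIntegrable _ _)
  rw [barrier_at h0 h1 hα hrel hint] at e1
  rw [endRatio_at h1 hα hrel] at e2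
  linarith

/-- A function that vanishes at `α` and has a nonnegative derivative is nonnegative after `α`. -/
theorem nonneg_of_hasDerivAt {f f' : ℝ → ℝ} {a b : ℝ} (h0 : f a = 0)
    (hd : ∀ x ∈ Icc a b, HasDerivAt f (f' x) x) (hf' : ∀ x ∈ Icc a b, 0 ≤ f' x) {x : ℝ}
    (hx : x ∈ Icc a b) : 0 ≤ f x := by
  have hm : MonotoneOn f (Icc a b) := by
    refine monotoneOn_of_deriv_nonneg (convex_Icc a b)
      (fun y hy => (hd y hy).continuousAt.continuousWithinAt) ?_ ?_
    · intro y hy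
      exact (hd y (interior_subset hy)).differentiableAt.differentiableWithinAt
    · intro y hy
      rw [(hd y (interior_subset hy)).deriv]
      exact hf' y (interior_subset hy)
  rw [← h0]
  exact hm ⟨le_rfl, hx.1.trans hx.2⟩ hx hx.1

/-- The two sides agree at α, the left decreases in x and the right increases. This change of sign
at α decides which formula for the barrier is valid on which side. -/
theorem neg_log_le_affine (h0 : 0 < Γ) (h1 : Γ < 1) (hα : α ∈ Ioo (0 : ℝ) 1)
    (hrel : (1 - Γ) * (-Real.log α - 1) = Γ * α) {x : ℝ} (hx : α ≤ x) :
    (1 - Γ) * -Real.log x ≤ 1 - Γ + Γ * x := by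
  have h2 := Real.log_le_log hα.1 hx
  have h3 := affine_at hrel
  nlinarith [mul_le_mul_of_nonneg_left h2 (sub_pos.2 h1).le, mul_le_mul_of_nonneg_left hx h0.le]

theorem affine_le_neg_log (h0 : 0 < Γ) (h1 : Γ < 1)
    (hrel : (1 - Γ) * (-Real.log α - 1) = Γ * α) {x : ℝ} (hx0 : 0 < x) (hx : x ≤ α) :
    1 - Γ + Γ * x ≤ (1 - Γ) * -Real.log x := by
  have h2 := Real.log_le_log hx0 hx
  have h3 := affine_at hrel
  nlinarith [mul_le_mul_of_nonneg_left h2 (sub_pos.2 h1).le, mul_le_mul_of_nonneg_left hx h0.le]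

theorem hasDerivAt_lowG {x : ℝ} (hx : 0 < x) : HasDerivAt (lowG Γ) (Γ * -Real.log x) x := by
  have h2 := (((hasDerivAt_id x).sub (Real.hasDerivAt_mul_log hx.ne')).const_mul Γ).const_add
    (1 - Γ)
  convert! h2 using 1
  ring

/-- This is `deriv_ge` on [α, 1] in the extreme case P = 1. Equality holds at α, and
`neg_log_le_affine` gives the sign of the derivative of the difference. -/
theorem one_sub_barrier_le (h0 : 0 < Γ) (h1 : Γ < 1) (hα : α ∈ Ioo (0 : ℝ) 1)
    (hrel : (1 - Γ) * (-Real.log α - 1) = Γ * α)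
    (hint : ∫ x in α..1, Γ / lowG Γ x = -1 / Real.log α) {x : ℝ} (hx : x ∈ Icc α 1) :
    1 - barrier Γ α x ≤ (1 - Γ + Γ * x) / lowG Γ x := by
  have hb := continuous_barrierDeriv h0 h1 hα hrel
  have key := nonneg_of_hasDerivAt (a := α) (b := 1)
    (f := fun y => (1 - Γ + Γ * y) / lowG Γ y + barrier Γ α y - 1)
    (f' := fun y => (Γ * lowG Γ y - (1 - Γ + Γ * y) * (Γ * -Real.log y)) / lowG Γ y ^ 2 +
      barrierDeriv Γ α y) ?_ ?_ ?_ hx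
  · linarith
  · have hl := Real.log_neg hα.1 hα.2
    have h2 : 1 - Γ ≠ 0 := (sub_pos.2 h1).ne'
    have := hl.ne
    simp only [barrier_at h0 h1 hα hrel hint, lowG_at hrel, affine_at hrel]
    field_simp
    ring
  · intro y hy
    have hy0 : 0 < y := hα.1.trans_le hy.1
    have hA : HasDerivAt (fun y => 1 - Γ + Γ * y) Γ y := by
      simpa using ((hasDerivAt_id y).const_mul Γ).const_add (1 - Γ)
    exact ((hA.div (hasDerivAt_lowG hy0) (lowG_pos h0 h1 ⟨hy0.le, hy.2⟩).ne').add
      (hasDerivAt_barrier hb y)).sub_const 1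
  · intro y hy
    have hy0 : 0 < y := hα.1.trans_le hy.1
    have hH := lowG_pos h0 h1 ⟨hy0.le, hy.2⟩
    have hA := affine_pos h0 h1 hy0.le
    have h3 := neg_log_le_affine h0 h1 hα hrel hy.1
    have hl := Real.mul_log_nonpos hy0.le hy.2
    simp only [barrierDeriv_of_ge h0 h1 hα hrel hy]
    have e : (Γ * lowG Γ y - (1 - Γ + Γ * y) * (Γ * -Real.log y)) / lowG Γ y ^ 2 +
        Γ / lowG Γ y = Γ * (2 * (1 - Γ + Γ * y) - Γ * (y * Real.log y) -
          (1 - Γ) * -Real.log y) / lowG Γ y ^ 2 := by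
      field_simp
      unfold lowG
      ring
    rw [e]
    refine div_nonneg (mul_nonneg h0.le ?_) (sq_nonneg _)
    nlinarith [mul_nonneg h0.le (neg_nonneg.2 hl)]

/-- Equality holds at α. To the right of α the barrier grows at least as fast, since (1 - Γ) `lowG`
≤ (1 - Γ + Γ x)² there. -/
theorem endRatio_le_barrier (h0 : 0 < Γ) (h1 : Γ < 1) (hα : α ∈ Ioo (0 : ℝ) 1)
    (hrel : (1 - Γ) * (-Real.log α - 1) = Γ * α)
    (hint : ∫ x in α..1, Γ / lowG Γ x = -1 / Real.log α) {x : ℝ} (hx : x ∈ Icc α 1) :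
    Γ * x / (1 - Γ + Γ * x) ≤ barrier Γ α x := by
  have hb := continuous_barrierDeriv h0 h1 hα hrel
  have key := nonneg_of_hasDerivAt (a := α) (b := 1)
    (f := fun y => barrier Γ α y - Γ * y / (1 - Γ + Γ * y))
    (f' := fun y => barrierDeriv Γ α y - Γ * (1 - Γ) / (1 - Γ + Γ * y) ^ 2) ?_ ?_ ?_ hx
  · linarith
  · simp only [barrier_at h0 h1 hα hrel hint, endRatio_at h1 hα hrel, sub_self]
  · intro y hy
    exact (hasDerivAt_barrier hb y).sub (hasDerivAt_endRatio h0 h1 (hα.1.le.trans hy.1))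
  · intro y hy
    have hy0 : 0 < y := hα.1.trans_le hy.1
    have hH := lowG_pos h0 h1 ⟨hy0.le, hy.2⟩
    have hA := affine_pos h0 h1 hy0.le
    have h3 := neg_log_le_affine h0 h1 hα hrel hy.1
    simp only [barrierDeriv_of_ge h0 h1 hα hrel hy]
    rw [sub_nonneg, div_le_div_iff₀ (by positivity) hH, mul_assoc]
    refine mul_le_mul_of_nonneg_left ?_ h0.le
    have h4 := mul_le_mul_of_nonneg_left h3 (mul_nonneg h0.le hy0.le)
    unfold lowG
    nlinarith

theorem isBarrier (h0 : 0 < Γ) (h1 : Γ < 1) (hα : α ∈ Ioo (0 : ℝ) 1)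
    (hrel : (1 - Γ) * (-Real.log α - 1) = Γ * α)
    (hint : ∫ x in α..1, Γ / lowG Γ x = -1 / Real.log α) :
    IsBarrier Γ (barrier Γ α) (barrierDeriv Γ α) := by
  have hb := continuous_barrierDeriv h0 h1 hα hrel
  refine ⟨by simp [barrier], hasDerivAt_barrier hb, hb, fun x hx => ?_, fun x hx P hP => ?_,
    fun x hx => ?_⟩
  · have hnn : 0 ≤ ∫ y in x..1, barrierDeriv Γ α y := by
      refine intervalIntegral.integral_nonneg hx.2 fun y hy => ?_
      unfold barrierDeriv
      split_ifs
      · exact div_nonneg (mul_nonneg h0.le (sub_pos.2 h1).le) (sq_nonneg _)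
      · exact div_nonneg h0.le (lowG_pos h0 h1 (clampUnit_mem y)).le
    rw [barrier, intervalIntegral.integral_symm]
    linarith
  · have hA := affine_pos h0 h1 hx.1
    have hH := lowG_pos h0 h1 hx
    rcases le_total x α with hxα | hxα
    · rw [barrierDeriv_of_le hα ⟨hx.1, hxα⟩, barrier_of_le h0 h1 hα hrel hint ⟨hx.1, hxα⟩,
        div_mul_eq_mul_div (Γ * (1 - Γ)), le_div_iff₀ (by positivity)]
      -- To the left of α, `deriv_ge` is an equality at P = 1, so only the coefficients of 1 - P
      -- have to be compared.
      have e : Γ * (1 - Γ * x / (1 - Γ + Γ * x) * P) * (1 - Γ + Γ * x) ^ 2 =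
          Γ * ((1 - Γ + Γ * x) * (1 - Γ) + (1 - P) * (Γ * (x * (1 - Γ + Γ * x)))) := by
        field_simp
        ring
      rw [e, mul_assoc]
      refine mul_le_mul_of_nonneg_left ?_ h0.le
      have h2 : x * (1 - Γ + Γ * x) ≤ (1 - Γ) * -(x * Real.log x) := by
        rcases eq_or_lt_of_le hx.1 with rfl | hx0
        · simp
        · have := mul_le_mul_of_nonneg_left (affine_le_neg_log h0 h1 hrel hx0 hxα) hx0.le
          linarith
      have h3 := mul_le_mul_of_nonneg_left (mul_le_mul_of_nonneg_left h2 h0.le)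
        (sub_nonneg.2 hP.2)
      linarith
    · rw [barrierDeriv_of_ge h0 h1 hα hrel ⟨hxα, hx.2⟩, div_mul_eq_mul_div, le_div_iff₀ hH,
        mul_assoc]
      refine mul_le_mul_of_nonneg_left ?_ h0.le
      have h2 := one_sub_barrier_le h0 h1 hα hrel hint ⟨hxα, hx.2⟩
      rw [le_div_iff₀ hH] at h2
      -- To the right of α both sides are affine in P: P = 0 is an equality by the choice of the
      -- derivative, and P = 1 is `h2`.
      have h3 : P * (-Γ * (x * Real.log x)) ≤ P * (barrier Γ α x * lowG Γ x) := by
        refine mul_le_mul_of_nonneg_left ?_ hP.1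
        have : lowG Γ x = 1 - Γ + Γ * x - Γ * (x * Real.log x) := by unfold lowG; ring
        linarith
      have e : lowG Γ x = 1 - Γ + Γ * (x - (x * Real.log x)) := rfl
      linarith
  · have hA := affine_pos h0 h1 hx.1
    rw [← div_le_iff₀ hA]
    rcases le_total x α with hxα | hxα
    · exact (barrier_of_le h0 h1 hα hrel hint ⟨hx.1, hxα⟩).ge
    · exact endRatio_le_barrier h0 h1 hα hrel hint ⟨hxα, hx.2⟩

end Barrier

/-! ### The equation for α: uniqueness and quadrature bounds. -/

section Constants

/-- The function `x - x log x`. -/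
noncomputable def hFun (x : ℝ) : ℝ := x - x * Real.log x

theorem continuous_hFun : Continuous hFun := by
  have := Real.continuous_mul_log
  unfold hFun
  fun_prop

theorem hFun_nonneg {x : ℝ} (hx : x ∈ Icc (0 : ℝ) 1) : 0 ≤ hFun x := by
  have := Real.mul_log_nonpos hx.1 hx.2
  unfold hFun
  linarith [hx.1]

theorem hFun_le_one {x : ℝ} (hx : 0 < x) : hFun x ≤ 1 := by
  have h1 := Real.one_sub_inv_le_log_of_pos hx
  have h2 := mul_le_mul_of_nonneg_left h1 hx.le
  rw [mul_sub, mul_inv_cancel₀ hx.ne'] at h2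
  unfold hFun
  linarith

/-- The integral whose equality with `-1 / log β` determines the constant. -/
noncomputable def kernelIntegral (k β : ℝ) : ℝ := ∫ x in β..1, 1 / (k + hFun x)

/-- The parameter `k` as a function of `β`. -/
noncomputable def kFun (β : ℝ) : ℝ := β / (-Real.log β - 1)

theorem alphaEq_iff {β : ℝ} (hl : Real.log β < -1) :
    AlphaEq β ↔ kernelIntegral (kFun β) β = -1 / Real.log β := by
  have h1 : Real.log β + 1 ≠ 0 := by linarith
  have h2 : -Real.log β - 1 ≠ 0 := by linarith
  have e : (fun x => (Real.log β + 1) / ((Real.log β + 1) * (-x * Real.log x + x) - β)) =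
      fun x => 1 / (kFun β + hFun x) := by
    funext x
    have : (Real.log β + 1) * (-x * Real.log x + x) - β =
        (Real.log β + 1) * (kFun β + hFun x) := by
      unfold kFun hFun
      field_simp
      ring
    rw [this, one_div, div_mul_eq_div_div, div_self h1, one_div]
  unfold AlphaEq kernelIntegral
  rw [e, neg_div]
  constructor <;> intro h <;> linarith

/-- If log β ≥ -1, then `hFun` ≤ 1 and log β ≤ β - 1 make the denominator nonpositive. The integral
is then nonpositive while 1 / log β < 0, so the sum cannot vanish. -/
theorem log_lt_of_alphaEq {β : ℝ} (hβ : β ∈ Ioo (0 : ℝ) 1) (h : AlphaEq β) :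
    Real.log β < -1 := by
  by_contra hneg
  have hl := Real.log_neg hβ.1 hβ.2
  have ha : 0 ≤ Real.log β + 1 := by linarith
  have hlt := Real.log_le_sub_one_of_pos hβ.1
  have h1 : ∫ x in β..1, (Real.log β + 1) /
      ((Real.log β + 1) * (-x * Real.log x + x) - β) ≤ ∫ _ in β..1, (0 : ℝ) := by
    rw [intervalIntegral.integral_zero, ← neg_nonneg, ← intervalIntegral.integral_neg]
    refine intervalIntegral.integral_nonneg hβ.2.le fun x hx => ?_
    rw [neg_nonneg]
    refine div_nonpos_of_nonneg_of_nonpos ha ?_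
    have h2 := hFun_le_one (hβ.1.trans_le hx.1)
    have h3 : -x * Real.log x + x = hFun x := by unfold hFun; ring
    rw [h3]
    nlinarith [mul_le_mul_of_nonneg_left h2 ha]
  rw [intervalIntegral.integral_zero] at h1
  have h4 : 1 / Real.log β < 0 := one_div_neg.2 hl
  unfold AlphaEq at h
  linarith

theorem kernel_intervalIntegrable {k a b : ℝ} (hk : 0 < k) (ha : a ∈ Icc (0 : ℝ) 1)
    (hb : b ∈ Icc (0 : ℝ) 1) : IntervalIntegrable (fun x => 1 / (k + hFun x)) volume a b := by
  refine ContinuousOn.intervalIntegrable ?_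
  refine continuousOn_const.div (continuous_const.add continuous_hFun).continuousOn fun x hx => ?_
  have := hFun_nonneg (uIcc_subset_Icc ha hb hx)
  positivity

theorem kernelIntegral_anti {k₁ k₂ a b : ℝ} (hk : 0 < k₁) (hk' : k₁ ≤ k₂) (ha : 0 ≤ a)
    (hab : a ≤ b) (hb : b ≤ 1) : kernelIntegral k₂ b ≤ kernelIntegral k₁ a := by
  have ha' : a ∈ Icc (0 : ℝ) 1 := ⟨ha, hab.trans hb⟩
  have hb' : b ∈ Icc (0 : ℝ) 1 := ⟨ha.trans hab, hb⟩
  have h1' : (1 : ℝ) ∈ Icc (0 : ℝ) 1 := by simp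
  have h1 : kernelIntegral k₂ b ≤ kernelIntegral k₁ b := by
    refine intervalIntegral.integral_mono_on hb (kernel_intervalIntegrable (hk.trans_le hk') hb' h1')
      (kernel_intervalIntegrable hk hb' h1') fun x hx => ?_
    have := hFun_nonneg (x := x) ⟨hb'.1.trans hx.1, hx.2⟩
    exact one_div_le_one_div_of_le (by positivity) (by linarith)
  have h2 : 0 ≤ ∫ x in a..b, 1 / (k₁ + hFun x) := by
    refine intervalIntegral.integral_nonneg hab fun x hx => ?_
    have := hFun_nonneg (x := x) ⟨ha.trans hx.1, hx.2.trans hb⟩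
    positivity
  have h3 := intervalIntegral.integral_add_adjacent_intervals
    (kernel_intervalIntegrable hk ha' hb') (kernel_intervalIntegrable hk hb' h1')
  unfold kernelIntegral at *
  linarith

/-- `kFun` increases with β and `kernelIntegral` decreases in both arguments, whereas -1 / log β
strictly increases. -/
theorem alphaEq_unique {β₁ β₂ : ℝ} (h₁ : β₁ ∈ Ioo (0 : ℝ) 1) (h₂ : β₂ ∈ Ioo (0 : ℝ) 1)
    (e₁ : AlphaEq β₁) (e₂ : AlphaEq β₂) : β₁ = β₂ := by
  wlog hlt : β₁ < β₂ generalizing β₁ β₂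
  · rcases eq_or_lt_of_le (not_lt.1 hlt) with h | h
    · exact h.symm
    · exact (this h₂ h₁ e₂ e₁ h).symm
  have l₁ := log_lt_of_alphaEq h₁ e₁
  have l₂ := log_lt_of_alphaEq h₂ e₂
  rw [alphaEq_iff l₁] at e₁
  rw [alphaEq_iff l₂] at e₂
  have hl := Real.log_lt_log h₁.1 hlt
  have hk : kFun β₁ ≤ kFun β₂ :=
    div_le_div₀ h₂.1.le hlt.le (by linarith) (by linarith)
  have h3 := kernelIntegral_anti (div_pos h₁.1 (by linarith)) hk h₁.1.le hlt.le h₂.2.le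
  change kernelIntegral (kFun β₂) β₂ ≤ kernelIntegral (kFun β₁) β₁ at h3
  have h4 := one_div_lt_one_div_of_lt (by linarith : 0 < -Real.log β₂) (neg_lt_neg hl)
  rw [e₁, e₂, neg_div, ← div_neg, neg_div, ← div_neg] at h3
  linarith

/-- The trapezoidal rule bounds the integral from above, since the integrand is convex. -/
theorem kernel_piece_le {k a b : ℝ} (hk : 0 < k) (ha : 0 < a) (hab : a ≤ b) (hb : b ≤ 1) :
    ∫ x in a..b, 1 / (k + hFun x) ≤
      (b - a) / 2 * (1 / (k + hFun a) + 1 / (k + hFun b)) := by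
  rcases eq_or_lt_of_le hab with rfl | hlt
  · simp
  have ha' : a ∈ Icc (0 : ℝ) 1 := ⟨ha.le, hab.trans hb⟩
  have hb' : b ∈ Icc (0 : ℝ) 1 := ⟨ha.le.trans hab, hb⟩
  have hA : 0 < k + hFun a := by have := hFun_nonneg ha'; positivity
  have hB : 0 < k + hFun b := by have := hFun_nonneg hb'; positivity
  set A := k + hFun a with hAdef
  set B := k + hFun b with hBdef
  -- The reciprocal of a positive concave function is convex: concavity bounds the denominator below
  -- by its chord (`h2`), and convexity of 1/u then bounds the integrand above by its own chord
  -- (`h4`).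
  have hconc : ConcaveOn ℝ (Icc (0 : ℝ) 1) hFun := by
    have h1 := Real.concaveOn_negMulLog.subset (Icc_subset_Ici_self (a := (1 : ℝ)) (b := 0))
      (convex_Icc 0 1)
    have h2 := (concaveOn_id (𝕜 := ℝ) (convex_Icc (0 : ℝ) 1)).add h1
    refine h2.congr fun x _ => ?_
    simp [hFun, Real.negMulLog]
    ring
  calc ∫ x in a..b, 1 / (k + hFun x)
      ≤ ∫ x in a..b, (1 / A + (x - a) * ((1 / B - 1 / A) / (b - a))) := by
        refine intervalIntegral.integral_mono_on hab (kernel_intervalIntegrable hk ha' hb')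
          (by apply Continuous.intervalIntegrable; fun_prop) fun x hx => ?_
        have hba : 0 < b - a := sub_pos.2 hlt
        set c := (x - a) / (b - a) with hc
        have hc0 : 0 ≤ c := div_nonneg (sub_nonneg.2 hx.1) hba.le
        have hc1 : 0 ≤ 1 - c := by
          rw [sub_nonneg, hc, div_le_one hba]
          linarith [hx.2]
        have hx' : (1 - c) * a + c * b = x := by rw [hc]; field_simp; ring
        have h1 := hconc.2 ha' hb' hc1 hc0 (by ring)
        simp only [smul_eq_mul, hx'] at h1
        have h2 : (1 - c) * A + c * B ≤ k + hFun x := by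
          rw [hAdef, hBdef]
          linarith
        have h3 : 0 < (1 - c) * A + c * B := by
          rcases eq_or_lt_of_le hc0 with h | h
          · rw [← h]; linarith
          · nlinarith [mul_pos h hB, mul_nonneg hc1 hA.le]
        have h4 : 1 / ((1 - c) * A + c * B) ≤ (1 - c) * (1 / A) + c * (1 / B) := by
          rw [div_le_iff₀ h3]
          have : ((1 - c) * (1 / A) + c * (1 / B)) * ((1 - c) * A + c * B) =
              1 + (1 - c) * c * (A - B) ^ 2 / (A * B) := by
            field_simp
            ring
          rw [this]
          have : 0 ≤ (1 - c) * c * (A - B) ^ 2 / (A * B) := by positivity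
          linarith
        refine (one_div_le_one_div_of_le h3 h2).trans (h4.trans_eq ?_)
        rw [hc]
        field_simp
        ring
    _ = (b - a) / 2 * (1 / A + 1 / B) := by
        have hne : b - a ≠ 0 := (sub_pos.2 hlt).ne'
        rw [intervalIntegral.integral_add (by simp) (by
          apply Continuous.intervalIntegrable; fun_prop), intervalIntegral.integral_mul_const,
          intervalIntegral.integral_sub (by simp) (by simp)]
        simp only [intervalIntegral.integral_const, integral_id, smul_eq_mul]
        field_simp
        ring

/-- A tangent line bounds the integral from below, since the integrand is convex. -/
theorem le_kernel_piece {k a b m : ℝ} (hk : 0 < k) (ha : 0 < a) (hab : a ≤ b) (hb : b ≤ 1)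
    (hm : m ∈ Ioc (0 : ℝ) 1) :
    (b - a) * (1 / (k + hFun m) + Real.log m * ((a + b) / 2 - m) / (k + hFun m) ^ 2) ≤
      ∫ x in a..b, 1 / (k + hFun x) := by
  have hA : 0 < k + hFun m := by have := hFun_nonneg (Ioc_subset_Icc_self hm); positivity
  set A := k + hFun m with hAdef
  calc (b - a) * (1 / A + Real.log m * ((a + b) / 2 - m) / A ^ 2)
      = ∫ x in a..b, (1 / A + (x - m) * (Real.log m / A ^ 2)) := by
        rw [intervalIntegral.integral_add (by simp) (by
          apply Continuous.intervalIntegrable; fun_prop), intervalIntegral.integral_mul_const,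
          intervalIntegral.integral_sub (by simp) (by simp)]
        simp only [intervalIntegral.integral_const, integral_id, smul_eq_mul]
        ring
    _ ≤ ∫ x in a..b, 1 / (k + hFun x) := by
        refine intervalIntegral.integral_mono_on hab
          (by apply Continuous.intervalIntegrable; fun_prop)
          (kernel_intervalIntegrable hk ⟨ha.le, hab.trans hb⟩ ⟨ha.le.trans hab, hb⟩)
          fun x hx => ?_
        have hx0 : 0 < x := ha.trans_le hx.1
        have hX : 0 < k + hFun x := by
          have := hFun_nonneg (x := x) ⟨hx0.le, hx.2.trans hb⟩
          positivity
        -- The tangent of the concave `hFun` at m has slope -log m. With X = k + `hFun` x, the rest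
        -- is (2A - X) X ≤ A².
        have h1 : k + hFun x ≤ A - Real.log m * (x - m) := by
          have h2 := Real.log_le_sub_one_of_pos (div_pos hm.1 hx0)
          rw [Real.log_div hm.1.ne' hx0.ne'] at h2
          have h3 := mul_le_mul_of_nonneg_left h2 hx0.le
          have h4 : x * (m / x - 1) = m - x := by field_simp
          rw [hAdef]
          unfold hFun
          linarith
        rw [le_div_iff₀ hX]
        have h5 : (1 / A + (x - m) * (Real.log m / A ^ 2)) =
            (A + (x - m) * Real.log m) / A ^ 2 := by field_simp
        rw [h5, div_mul_eq_mul_div, div_le_one (by positivity)]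
        nlinarith [sq_nonneg (k + hFun x - A), h1]

end Constants

/-! ### Numerical enclosure of -log α. -/

section Numerics

theorem hFun_exp_pow (δ : ℝ) (j : ℕ) :
    hFun (Real.exp (-δ) ^ j) = Real.exp (-δ) ^ j * (1 + j * δ) := by
  unfold hFun
  rw [Real.log_pow, Real.log_exp]
  ring

theorem kernelIntegral_exp_pow {k δ : ℝ} (hk : 0 < k) (hδ : 0 ≤ δ) (N r : ℕ) :
    kernelIntegral k (Real.exp (-δ) ^ (r * N)) = ∑ j ∈ Finset.range N,
      ∫ x in Real.exp (-δ) ^ (r * (j + 1))..Real.exp (-δ) ^ (r * j), 1 / (k + hFun x) := by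
  have hmem : ∀ j : ℕ, Real.exp (-δ) ^ j ∈ Icc (0 : ℝ) 1 := fun j =>
    ⟨by positivity, pow_le_one₀ (Real.exp_pos _).le (Real.exp_le_one_iff.2 (by linarith))⟩
  have := intervalIntegral.sum_integral_adjacent_intervals (n := N) (μ := volume)
    (a := fun j => Real.exp (-δ) ^ (r * j)) (f := fun x => 1 / (k + hFun x))
    fun j _ => kernel_intervalIntegrable hk (hmem _) (hmem _)
  simp only [mul_zero, pow_zero] at this
  rw [kernelIntegral, intervalIntegral.integral_symm, ← this, ← Finset.sum_neg_distrib]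
  exact Finset.sum_congr rfl fun j _ => (intervalIntegral.integral_symm _ _).symm

/-- The trapezoidal rule on the geometric grid e^{-jδ}, where `hFun` is e^{-jδ}(1 + jδ). Once e^{-δ}
is enclosed between s₁ and s₂, the bound is rational. -/
theorem kernelIntegral_le_sum {k k' δ s₁ s₂ : ℝ} (hk' : 0 < k') (hk : k' ≤ k) (hδ : 0 ≤ δ)
    (hs : 0 < s₁) (h₁ : s₁ ≤ Real.exp (-δ)) (h₂ : Real.exp (-δ) ≤ s₂) (N : ℕ) :
    kernelIntegral k (Real.exp (-δ) ^ N) ≤ ∑ j ∈ Finset.range N,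
      (s₂ ^ j - s₁ ^ (j + 1)) / 2 * (1 / (k' + s₁ ^ (j + 1) * (1 + ((j + 1 : ℕ) : ℝ) * δ)) +
        1 / (k' + s₁ ^ j * (1 + (j : ℝ) * δ))) := by
  have h := kernelIntegral_exp_pow (hk'.trans_le hk) hδ N 1
  simp only [one_mul] at h
  rw [h]
  refine Finset.sum_le_sum fun j _ => ?_
  have hs1 : Real.exp (-δ) ≤ 1 := Real.exp_le_one_iff.2 (by linarith)
  have hs0 := Real.exp_pos (-δ)
  refine (kernel_piece_le (hk'.trans_le hk) (by positivity)
    (pow_le_pow_of_le_one hs0.le hs1 (Nat.le_succ j)) (pow_le_one₀ hs0.le hs1)).trans ?_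
  rw [hFun_exp_pow, hFun_exp_pow]
  have hle : s₁ ^ (j + 1) ≤ s₂ ^ j := (pow_le_pow_left₀ hs.le h₁ _).trans
    ((pow_le_pow_of_le_one hs0.le hs1 (Nat.le_succ j)).trans (pow_le_pow_left₀ hs0.le h₂ _))
  have hle' : 0 ≤ (s₂ ^ j - s₁ ^ (j + 1)) / 2 := by linarith
  refine mul_le_mul ?_ ?_ (by have := hk'.trans_le hk; positivity) hle'
  · gcongr
  · gcongr

/-- Tangent lines at the odd nodes, each used across two grid steps. An odd node is the geometric
and not the arithmetic midpoint of its neighbours, hence the first-order correction. -/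
theorem sum_le_kernelIntegral {k k₁ k₂ δ s₁ s₂ : ℝ} (hk0 : 0 < k₁) (hk1 : k₁ ≤ k) (hk : k ≤ k₂)
    (hδ : 0 ≤ δ) (hs : 0 < s₁) (h₁ : s₁ ≤ Real.exp (-δ)) (h₂ : Real.exp (-δ) ≤ s₂) (N : ℕ)
    (hpos : ∀ j < N, s₂ ^ (2 * j + 2) ≤ s₁ ^ (2 * j) ∧
      0 ≤ 1 / (k₂ + s₂ ^ (2 * j + 1) * (1 + ((2 * j + 1 : ℕ) : ℝ) * δ)) -
        ((2 * j + 1 : ℕ) : ℝ) * δ * ((s₂ ^ (2 * j + 2) + s₂ ^ (2 * j)) / 2 - s₁ ^ (2 * j + 1)) /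
          (k₁ + s₁ ^ (2 * j + 1) * (1 + ((2 * j + 1 : ℕ) : ℝ) * δ)) ^ 2) :
    ∑ j ∈ Finset.range N, (s₁ ^ (2 * j) - s₂ ^ (2 * j + 2)) *
      (1 / (k₂ + s₂ ^ (2 * j + 1) * (1 + ((2 * j + 1 : ℕ) : ℝ) * δ)) -
        ((2 * j + 1 : ℕ) : ℝ) * δ * ((s₂ ^ (2 * j + 2) + s₂ ^ (2 * j)) / 2 - s₁ ^ (2 * j + 1)) /
          (k₁ + s₁ ^ (2 * j + 1) * (1 + ((2 * j + 1 : ℕ) : ℝ) * δ)) ^ 2) ≤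
    kernelIntegral k (Real.exp (-δ) ^ (2 * N)) := by
  have hkpos := hk0.trans_le hk1
  rw [kernelIntegral_exp_pow hkpos hδ N 2]
  refine Finset.sum_le_sum fun j hj => ?_
  obtain ⟨hp1, hp2⟩ := hpos j (Finset.mem_range.1 hj)
  have hs1 : Real.exp (-δ) ≤ 1 := Real.exp_le_one_iff.2 (by linarith)
  have hs0 := Real.exp_pos (-δ)
  have hle : Real.exp (-δ) ^ (2 * j + 2) ≤ Real.exp (-δ) ^ (2 * j) :=
    pow_le_pow_of_le_one hs0.le hs1 (by omega)
  refine le_trans ?_ (le_kernel_piece (m := Real.exp (-δ) ^ (2 * j + 1)) hkpos (by positivity)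
    (by rw [mul_add]; exact hle) (pow_le_one₀ hs0.le hs1)
    ⟨by positivity, pow_le_one₀ hs0.le hs1⟩)
  rw [hFun_exp_pow, Real.log_pow, Real.log_exp, mul_add 2 j 1]
  set e := Real.exp (-δ)
  have b1 : s₁ ^ (2 * j) ≤ e ^ (2 * j) := pow_le_pow_left₀ hs.le h₁ _
  have b2 : e ^ (2 * j) ≤ s₂ ^ (2 * j) := pow_le_pow_left₀ hs0.le h₂ _
  have a2 : e ^ (2 * j + 2) ≤ s₂ ^ (2 * j + 2) := pow_le_pow_left₀ hs0.le h₂ _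
  have m1 : s₁ ^ (2 * j + 1) ≤ e ^ (2 * j + 1) := pow_le_pow_left₀ hs.le h₁ _
  have m2 : e ^ (2 * j + 1) ≤ s₂ ^ (2 * j + 1) := pow_le_pow_left₀ hs0.le h₂ _
  have hD : 0 ≤ (s₂ ^ (2 * j + 2) + s₂ ^ (2 * j)) / 2 - s₁ ^ (2 * j + 1) := by
    have hsq : e ^ (2 * j + 2) + e ^ (2 * j) - 2 * e ^ (2 * j + 1) =
        e ^ (2 * j) * (e - 1) ^ 2 := by ring
    have : 0 ≤ e ^ (2 * j) * (e - 1) ^ 2 := by positivity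
    linarith
  refine mul_le_mul (by rw [mul_one]; linarith) ?_ hp2 (by rw [mul_one]; linarith)
  have t1 : 1 / (k₂ + s₂ ^ (2 * j + 1) * (1 + ((2 * j + 1 : ℕ) : ℝ) * δ)) ≤
      1 / (k + e ^ (2 * j + 1) * (1 + ((2 * j + 1 : ℕ) : ℝ) * δ)) := by gcongr
  have t2 : ((2 * j + 1 : ℕ) : ℝ) * δ *
        ((e ^ (2 * j + 2) + e ^ (2 * j)) / 2 - e ^ (2 * j + 1)) /
          (k + e ^ (2 * j + 1) * (1 + ((2 * j + 1 : ℕ) : ℝ) * δ)) ^ 2 ≤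
      ((2 * j + 1 : ℕ) : ℝ) * δ * ((s₂ ^ (2 * j + 2) + s₂ ^ (2 * j)) / 2 - s₁ ^ (2 * j + 1)) /
          (k₁ + s₁ ^ (2 * j + 1) * (1 + ((2 * j + 1 : ℕ) : ℝ) * δ)) ^ 2 := by
    gcongr
  have e1 : ((2 * j + 1 : ℕ) : ℝ) * -δ *
        ((e ^ (2 * j + 2) + e ^ (2 * j)) / 2 - e ^ (2 * j + 1)) /
          (k + e ^ (2 * j + 1) * (1 + ((2 * j + 1 : ℕ) : ℝ) * δ)) ^ 2 =
      -(((2 * j + 1 : ℕ) : ℝ) * δ *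
        ((e ^ (2 * j + 2) + e ^ (2 * j)) / 2 - e ^ (2 * j + 1)) /
          (k + e ^ (2 * j + 1) * (1 + ((2 * j + 1 : ℕ) : ℝ) * δ)) ^ 2) := by ring
  simp only [mul_one]
  rw [e1]
  linarith

/-- The exponential at `-δ`, up to an error of order `δ ^ 6`. -/
theorem exp_neg_bounds {δ s₁ s₂ : ℝ} (h0 : 0 ≤ δ) (h1 : δ ≤ 1)
    (hs₁ : s₁ ≤ 1 - δ + δ ^ 2 / 2 - δ ^ 3 / 6 + δ ^ 4 / 24 - δ ^ 5 / 120 - δ ^ 6 * (7 / 4320))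
    (hs₂ : 1 - δ + δ ^ 2 / 2 - δ ^ 3 / 6 + δ ^ 4 / 24 - δ ^ 5 / 120 + δ ^ 6 * (7 / 4320) ≤ s₂) :
    s₁ ≤ Real.exp (-δ) ∧ Real.exp (-δ) ≤ s₂ := by
  have h := Real.exp_bound (x := -δ) (by rwa [abs_neg, abs_of_nonneg h0]) (n := 6) (by norm_num)
  rw [abs_neg, abs_of_nonneg h0, abs_le] at h
  norm_num [Finset.sum_range_succ, Nat.factorial] at h
  constructor <;> nlinarith [h.1, h.2]

theorem kFun_exp (U : ℝ) : kFun (Real.exp (-U)) = Real.exp (-U) / (U - 1) := by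
  rw [kFun, Real.log_exp, neg_neg]

theorem exp_pow_14 : Real.exp (-0.1111) ^ 14 = Real.exp (-1.5554) := by
  rw [← Real.exp_nat_mul]
  norm_num

theorem exp_pow_20 : Real.exp (-0.07785) ^ 20 = Real.exp (-1.557) := by
  rw [← Real.exp_nat_mul]
  norm_num

theorem exp_14_bounds : 0.8948492 ≤ Real.exp (-0.1111) ∧ Real.exp (-0.1111) ≤ 0.8948493 :=
  exp_neg_bounds (by norm_num) (by norm_num) (by norm_num) (by norm_num)

theorem exp_20_bounds : 0.9251031 ≤ Real.exp (-0.07785) ∧ Real.exp (-0.07785) ≤ 0.9251032 :=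
  exp_neg_bounds (by norm_num) (by norm_num) (by norm_num) (by norm_num)

theorem exp_14_pow_bounds : 0.2111 ≤ Real.exp (-1.5554) ∧ Real.exp (-1.5554) ≤ 0.2111060 := by
  rw [← exp_pow_14]
  have h := exp_14_bounds
  exact ⟨le_trans (by norm_num) (pow_le_pow_left₀ (by norm_num) h.1 14),
    (pow_le_pow_left₀ (Real.exp_pos _).le h.2 14).trans (by norm_num)⟩

theorem exp_20_pow_bounds : 0.210766 ≤ Real.exp (-1.557) ∧ Real.exp (-1.557) ≤ 0.210768 := by
  rw [← exp_pow_20]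
  have h := exp_20_bounds
  exact ⟨le_trans (by norm_num) (pow_le_pow_left₀ (by norm_num) h.1 20),
    (pow_le_pow_left₀ (Real.exp_pos _).le h.2 20).trans (by norm_num)⟩

/-- With 14 steps of length 0.1111 this gives one sign for the intermediate value theorem in U; the
tangent rule with 20 steps of 0.07785 gives the opposite sign at 1.557. -/
theorem kernelIntegral_lower_end :
    kernelIntegral (kFun (Real.exp (-1.5554))) (Real.exp (-1.5554)) ≤ 1 / 1.5554 := by
  have hb := exp_14_pow_bounds
  have hk : (0.2111 / 0.5554 : ℝ) ≤ kFun (Real.exp (-1.5554)) := by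
    rw [kFun_exp, show (1.5554 : ℝ) - 1 = 0.5554 by norm_num]
    gcongr
    exact hb.1
  have h := kernelIntegral_le_sum (by norm_num) hk (δ := 0.1111) (by norm_num) (by norm_num)
    exp_14_bounds.1 exp_14_bounds.2 14
  rw [exp_pow_14] at h
  refine h.trans ?_
  simp only [Finset.sum_range_succ, Finset.sum_range_zero]
  norm_num

theorem kernelIntegral_upper_end :
    1 / 1.557 ≤ kernelIntegral (kFun (Real.exp (-1.557))) (Real.exp (-1.557)) := by
  have hb := exp_20_pow_bounds
  have hk1 : (0.210766 / 0.557 : ℝ) ≤ kFun (Real.exp (-1.557)) := by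
    rw [kFun_exp, show (1.557 : ℝ) - 1 = 0.557 by norm_num]
    gcongr
    exact hb.1
  have hk2 : kFun (Real.exp (-1.557)) ≤ (0.210768 / 0.557 : ℝ) := by
    rw [kFun_exp, show (1.557 : ℝ) - 1 = 0.557 by norm_num]
    gcongr
    exact hb.2
  have h := sum_le_kernelIntegral (by norm_num) hk1 hk2 (δ := 0.07785) (by norm_num)
    (by norm_num) exp_20_bounds.1 exp_20_bounds.2 10 (fun j hj => by
      interval_cases j <;> norm_num)
  rw [show 2 * 10 = 20 by norm_num, exp_pow_20] at h
  refine le_trans ?_ h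
  simp only [Finset.sum_range_succ, Finset.sum_range_zero]
  norm_num

end Numerics

/-! ### Existence and location of the constants. -/

section ConstantsExist

theorem continuousOn_kernelIntegral :
    ContinuousOn (fun U : ℝ => kernelIntegral (kFun (Real.exp (-U))) (Real.exp (-U)))
      (Icc 1.5554 1.557) := by
  -- Clamping U below at 1.5 and `hFun` below at 0 makes the integrand continuous on the whole
  -- plane, without changing it for the relevant U and x.
  have hden : ∀ z : ℝ × ℝ, 0 < Real.exp (-max z.1 1.5) / (max z.1 1.5 - 1) +
      max (hFun z.2) 0 := fun z => by
    have h1 : (1.5 : ℝ) ≤ max z.1 1.5 := le_max_right _ _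
    have h2 : 0 < max z.1 1.5 - 1 := by linarith
    have h3 : 0 ≤ max (hFun z.2) 0 := le_max_right _ _
    positivity
  have hc : Continuous (Function.uncurry fun U x : ℝ =>
      1 / (Real.exp (-max U 1.5) / (max U 1.5 - 1) + max (hFun x) 0)) := by
    refine continuous_const.div (((by fun_prop : Continuous fun z : ℝ × ℝ =>
      Real.exp (-max z.1 1.5)).div (by fun_prop) fun z => ?_).add
      ((continuous_hFun.comp continuous_snd).max continuous_const)) fun z => (hden z).ne'
    have h1 : (1.5 : ℝ) ≤ max z.1 1.5 := le_max_right _ _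
    linarith
  have h := (intervalIntegral.continuous_parametric_intervalIntegral_of_continuous (μ := volume)
    (a₀ := 1) hc (s := fun U : ℝ => Real.exp (-U)) (by fun_prop)).neg
  refine h.continuousOn.congr fun U hU => ?_
  have hU1 : (1.5 : ℝ) ≤ U := le_trans (by norm_num) hU.1
  rw [kernelIntegral, intervalIntegral.integral_symm]
  refine congrArg Neg.neg ?_
  refine intervalIntegral.integral_congr fun x hx => ?_
  have he : Real.exp (-U) ≤ 1 := Real.exp_le_one_iff.2 (by linarith)
  rw [uIcc_of_ge he] at hx
  have hx' : x ∈ Icc (0 : ℝ) 1 := ⟨(Real.exp_pos _).le.trans hx.1, hx.2⟩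
  simp only [kFun_exp]
  rw [max_eq_left hU1, max_eq_left (hFun_nonneg hx')]

theorem exists_alphaEq : ∃ U ∈ Icc (1.5554 : ℝ) 1.557, AlphaEq (Real.exp (-U)) := by
  have hc : ContinuousOn (fun U : ℝ =>
      kernelIntegral (kFun (Real.exp (-U))) (Real.exp (-U)) - 1 / U) (Icc 1.5554 1.557) :=
    continuousOn_kernelIntegral.sub (continuousOn_const.div continuousOn_id fun U hU =>
      (lt_of_lt_of_le (by norm_num) hU.1).ne')
  obtain ⟨U, hU, h⟩ := intermediate_value_Icc (by norm_num) hc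
    (show (0 : ℝ) ∈ _ from ⟨sub_nonpos.2 kernelIntegral_lower_end,
      sub_nonneg.2 kernelIntegral_upper_end⟩)
  have hU1 : (1.5554 : ℝ) ≤ U := hU.1
  refine ⟨U, hU, (alphaEq_iff ?_).2 ?_⟩
  · rw [Real.log_exp]
    linarith
  · rw [Real.log_exp, neg_div_neg_eq]
    simp only at h
    linarith

/-- The relation between Γ and α says that `kFun` α = (1 - Γ) / Γ, which turns the integral equation
into the value of the barrier at α. -/
theorem lowG_eq {Γ α : ℝ} (h1 : Γ < 1) (hrel : (1 - Γ) * (-Real.log α - 1) = Γ * α)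
    (hl : Real.log α < -1) (x : ℝ) : Γ / lowG Γ x = 1 / (kFun α + hFun x) := by
  have h2 : 1 - Γ ≠ 0 := (sub_pos.2 h1).ne'
  have h3 : -Real.log α - 1 ≠ 0 := by linarith
  by_cases h0 : Γ = 0
  · rw [h0] at hrel
    simp [h3] at hrel
  · have : lowG Γ x = Γ * (kFun α + hFun x) := by
      have : kFun α = (1 - Γ) / Γ := by
        rw [kFun, div_eq_div_iff h3 h0]
        linarith
      rw [this]
      unfold lowG hFun
      field_simp
    rw [this, ← div_div, div_self h0]

/-- The constants `α` and `Γ`, and the barrier that proves the arrival times well defined. -/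
theorem exists_constants : ∃ α : ℝ,
    (α ∈ Ioo (0 : ℝ) 1 ∧ AlphaEq α ∧ ∀ β ∈ Ioo (0 : ℝ) 1, AlphaEq β → β = α) ∧
    |α - 0.211| < 0.0005 ∧ |ratio α - 0.725| < 0.0005 ∧ 0 < ratio α ∧ ratio α < 1 ∧
    ∃ B b, IsBarrier (ratio α) B b := by
  obtain ⟨U, hU, hA⟩ := exists_alphaEq
  have hU1 : (1.5554 : ℝ) ≤ U := hU.1
  have hU2 : U ≤ (1.557 : ℝ) := hU.2
  set α := Real.exp (-U) with hα
  have hlog : Real.log α = -U := Real.log_exp _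
  have hlo : 0.210766 ≤ α :=
    exp_20_pow_bounds.1.trans (Real.exp_le_exp.2 (by linarith))
  have hhi : α ≤ 0.2111060 :=
    (Real.exp_le_exp.2 (by linarith)).trans exp_14_pow_bounds.2
  have hmem : α ∈ Ioo (0 : ℝ) 1 := ⟨Real.exp_pos _, by linarith⟩
  have hl : Real.log α < -1 := by rw [hlog]; linarith
  have hden : 0 < U - 1 + α := by linarith
  have hratio : ratio α = (U - 1) / (U - 1 + α) := by
    rw [ratio, hlog, ← neg_div_neg_eq]
    congr 1 <;> ring
  have hΓ0 : 0 < ratio α := by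
    rw [hratio]
    exact div_pos (by linarith) hden
  have hΓ1 : ratio α < 1 := by
    rw [hratio, div_lt_one hden]
    linarith
  have hrel : (1 - ratio α) * (-Real.log α - 1) = ratio α * α := by
    rw [hratio, hlog]
    field_simp
    ring
  refine ⟨α, ⟨hmem, hA, fun β hβ h => alphaEq_unique hβ hmem h hA⟩, ?_, ?_, hΓ0, hΓ1, _, _,
    isBarrier hΓ0 hΓ1 hmem hrel ?_⟩
  · rw [abs_lt]
    constructor <;> linarith
  -- The ratio (U - 1) / (U - 1 + α) increases in U and decreases in α. The largest value that the
  -- enclosures allow is about 0.72548, just below 0.7255.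
  · rw [hratio, abs_lt]
    constructor
    · rw [lt_sub_iff_add_lt, lt_div_iff₀ hden]
      linarith
    · rw [sub_lt_iff_lt_add, div_lt_iff₀ hden]
      linarith
  · rw [intervalIntegral.integral_congr fun x _ => lowG_eq hΓ1 hrel hl x]
    exact (alphaEq_iff hl).1 hA

end ConstantsExist

/-! ### Tail probabilities and threshold functions. -/

/-- The probability that a value exceeds the extended real number `x`. -/
noncomputable def tailProb (μ : Measure ℝ) (x : EReal) : ℝ := μ.real {y : ℝ | x < (y : EReal)}

theorem measurableSet_lt_coe (x : EReal) : MeasurableSet {y : ℝ | x < (y : EReal)} :=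
  measurableSet_lt measurable_const measurable_coe_real_ereal

theorem tailProb_anti (μ : Measure ℝ) [IsFiniteMeasure μ] : Antitone (tailProb μ) :=
  fun _ _ h => measureReal_mono fun _ hz => lt_of_le_of_lt h hz

theorem tailProb_mem (μ : Measure ℝ) [IsProbabilityMeasure μ] (x : EReal) :
    tailProb μ x ∈ Icc (0 : ℝ) 1 := ⟨measureReal_nonneg, measureReal_le_one⟩

theorem tailProb_bot (μ : Measure ℝ) [IsProbabilityMeasure μ] : tailProb μ ⊥ = 1 := by
  simp [tailProb]

theorem tailProb_top (μ : Measure ℝ) : tailProb μ ⊤ = 0 := by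
  simp [tailProb]

/-- Dominated convergence: the indicator of x < y is locally constant in x near x₀ unless y = x₀,
which has probability 0. -/
theorem continuous_tailProb (μ : Measure ℝ) [IsFiniteMeasure μ] (hμ : ∀ x, μ {x} = 0) :
    Continuous (tailProb μ) := by
  have e : tailProb μ = fun x => ∫ y, ({y : ℝ | x < (y : EReal)}.indicator 1 y : ℝ) ∂μ := by
    funext x
    rw [integral_indicator_one (measurableSet_lt_coe x)]
    rfl
  rw [e, continuous_iff_continuousAt]
  intro x₀
  refine tendsto_integral_filter_of_dominated_convergence (fun _ => 1) ?_ ?_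
    (integrable_const 1) ?_
  · exact Eventually.of_forall fun x =>
      (measurable_one.indicator (measurableSet_lt_coe x)).aestronglyMeasurable
  · refine Eventually.of_forall fun x => Eventually.of_forall fun y => ?_
    by_cases h : y ∈ {y : ℝ | x < (y : EReal)} <;> simp [h]
  · have hne : ∀ᵐ y : ℝ ∂μ, (y : EReal) ≠ x₀ := by
      have : {y : ℝ | ¬ (y : EReal) ≠ x₀} ⊆ ({x₀.toReal} : Set ℝ) := by
        intro y hy
        simp only [ne_eq, not_not, mem_ofPred_eq] at hy
        simp [← hy]
      exact measure_mono_null this (hμ _)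
    filter_upwards [hne] with y hy
    refine tendsto_const_nhds.congr' ?_
    rcases lt_or_gt_of_ne hy with h | h
    · filter_upwards [lt_mem_nhds h] with x hx
      simp [h.not_gt, hx.not_gt]
    · filter_upwards [gt_mem_nhds h] with x hx
      simp [h, hx]

section Product

variable {n : ℕ} {D : Fin n → Measure ℝ} [∀ i, IsProbabilityMeasure (D i)]

theorem prob_exists_lt (s : Finset (Fin n)) (x : EReal) :
    (Measure.pi D).real {v | ∃ j ∈ s, x < (v j : EReal)} =
      1 - ∏ j ∈ s, (1 - tailProb (D j) x) := by
  classical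
  have hms : MeasurableSet {v : Fin n → ℝ | ∃ j ∈ s, x < (v j : EReal)} := by
    have : {v : Fin n → ℝ | ∃ j ∈ s, x < (v j : EReal)} =
        ⋃ j ∈ s, (fun v : Fin n → ℝ => v j) ⁻¹' {y : ℝ | x < (y : EReal)} := by
      ext v; simp
    rw [this]
    exact Finset.measurableSet_biUnion s fun j _ => measurable_pi_apply j (measurableSet_lt_coe x)
  have hc : {v : Fin n → ℝ | ∃ j ∈ s, x < (v j : EReal)}ᶜ =
      Set.pi univ fun j => if j ∈ s then {y : ℝ | x < (y : EReal)}ᶜ else univ := by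
    ext v
    simp only [mem_compl_iff, mem_ofPred_eq, not_exists, not_and, Set.mem_pi, mem_univ, true_imp_iff]
    refine forall_congr' fun j => ?_
    by_cases hj : j ∈ s <;> simp [hj]
  have h1 : (Measure.pi D).real {v : Fin n → ℝ | ∃ j ∈ s, x < (v j : EReal)}ᶜ =
      ∏ j ∈ s, (1 - tailProb (D j) x) := by
    rw [hc, measureReal_def, Measure.pi_pi, ENNReal.toReal_prod, ← Finset.prod_subset
      (Finset.subset_univ s)]
    · refine Finset.prod_congr rfl fun j hj => ?_
      rw [if_pos hj, ← measureReal_def, probReal_compl_eq_one_sub (measurableSet_lt_coe x)]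
      rfl
    · intro j _ hj
      simp [hj]
  rw [probReal_compl_eq_one_sub hms] at h1
  linarith

theorem lt_maxVal_iff (hn : 1 ≤ n) (v : Fin n → ℝ) (x : EReal) :
    x < (maxVal v : EReal) ↔ ∃ j ∈ Finset.univ, x < (v j : EReal) := by
  have : Nonempty (Fin n) := ⟨⟨0, hn⟩⟩
  simp only [Finset.mem_univ, true_and]
  constructor
  · intro h
    obtain ⟨j, hj⟩ := exists_eq_ciSup_of_finite (f := v)
    exact ⟨j, by rwa [hj]⟩
  · rintro ⟨j, hj⟩
    exact hj.trans_le (EReal.coe_le_coe_iff.2 (le_ciSup (finite_range v).bddAbove j))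

theorem prob_lt_maxVal (hn : 1 ≤ n) (x : EReal) :
    (Measure.pi D).real {v | x < (maxVal v : EReal)} = 1 - ∏ j, (1 - tailProb (D j) x) := by
  simp only [lt_maxVal_iff hn]
  exact prob_exists_lt Finset.univ x

theorem maxTail_anti : Antitone fun x : EReal => 1 - ∏ j, (1 - tailProb (D j) x) := by
  intro x y hxy
  refine sub_le_sub_left (Finset.prod_le_prod (fun j _ => sub_nonneg.2 (tailProb_mem _ _).2)
    fun j _ => sub_le_sub_left (tailProb_anti _ hxy) _) _

/-- The exceedance probability H of the maximum is continuous on the compact space `EReal` and takes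
the values 1 and 0 at its ends. The supremum of {H ≥ t} is attained, and at t = 1 it is the largest
solution. -/
theorem exists_isThreshold (hn : 1 ≤ n) (hD : ∀ i x, D i {x} = 0) :
    ∃ τ : ℝ → EReal, IsThreshold D τ := by
  set H : EReal → ℝ := fun x => 1 - ∏ j, (1 - tailProb (D j) x) with hH
  have hc : Continuous H := continuous_const.sub (continuous_finsetProd _ fun j _ =>
    continuous_const.sub (continuous_tailProb _ (hD j)))
  have hbot : H ⊥ = 1 := by
    simp [hH, tailProb_bot, Finset.prod_const, zero_pow (Nat.one_le_iff_ne_zero.1 hn)]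
  have htop : H ⊤ = 0 := by simp [hH, tailProb_top]
  refine ⟨fun t => sSup {x | t ≤ H x}, ⟨fun t ht => ?_, fun x hx => ?_⟩⟩
  · rw [prob_lt_maxVal hn]
    obtain ⟨x₀, hx₀⟩ := mem_range_of_exists_le_of_exists_ge hc
      ⟨⊤, htop.trans_le ht.1⟩ ⟨⊥, hbot.symm ▸ ht.2⟩
    have hcl : IsClosed {x | t ≤ H x} := isClosed_le continuous_const hc
    have hmem : sSup {x | t ≤ H x} ∈ {x | t ≤ H x} :=
      hcl.isCompact.sSup_mem ⟨x₀, hx₀.ge⟩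
    refine le_antisymm ?_ hmem
    exact (maxTail_anti (le_sSup (show x₀ ∈ {x | t ≤ H x} from hx₀.ge))).trans hx₀.le
  · rw [prob_lt_maxVal hn] at hx
    exact le_sSup hx.ge

namespace IsThreshold

variable {τ : ℝ → EReal}

theorem prod_eq (hτ : IsThreshold D τ) (hn : 1 ≤ n) {t : ℝ} (ht : t ∈ Icc (0 : ℝ) 1) :
    ∏ j, (1 - tailProb (D j) (τ t)) = 1 - t := by
  have := hτ.prob_eq t ht
  rw [prob_lt_maxVal hn] at this
  linarith

theorem antitoneOn (hτ : IsThreshold D τ) (hn : 1 ≤ n) : AntitoneOn τ (Icc (0 : ℝ) 1) := by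
  intro s hs t ht hst
  rcases eq_or_lt_of_le hst with rfl | hlt
  · exact le_rfl
  · by_contra hneg
    have h1 := maxTail_anti (D := D) (not_le.1 hneg).le
    simp only [hτ.prod_eq hn hs, hτ.prod_eq hn ht] at h1
    linarith

/-- Any c > τ(1) has exceedance probability below 1 by maximality of τ(1), so τ(t) < c as soon as t
exceeds that probability. -/
theorem continuousWithinAt_one (hτ : IsThreshold D τ) (hn : 1 ≤ n) :
    ContinuousWithinAt τ (Icc (0 : ℝ) 1) 1 := by
  have h1 : (1 : ℝ) ∈ Icc (0 : ℝ) 1 := by simp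
  refine tendsto_order.2 ⟨fun c hc => ?_, fun c hc => ?_⟩
  · filter_upwards [self_mem_nhdsWithin] with t ht
    exact hc.trans_le (hτ.antitoneOn hn ht h1 ht.2)
  · have hlt : 1 - ∏ j, (1 - tailProb (D j) c) < 1 := by
      refine lt_of_le_of_ne ?_ fun h => ?_
      · rw [← prob_lt_maxVal hn]
        exact measureReal_le_one
      · rw [← prob_lt_maxVal hn] at h
        exact absurd (hτ.greatest_one c h) (not_le.2 hc)
    filter_upwards [self_mem_nhdsWithin, mem_nhdsWithin_of_mem_nhds (lt_mem_nhds hlt)]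
      with t ht ht'
    by_contra hneg
    have h2 := maxTail_anti (D := D) (not_lt.1 hneg)
    simp only [hτ.prod_eq hn ht] at h2
    linarith

theorem exceedSystem (hτ : IsThreshold D τ) (hn : 1 ≤ n) (hD : ∀ i x, D i {x} = 0) :
    ExceedSystem (exceedProb D τ) (othersProb D τ) where
  p_mem i t _ := tailProb_mem (D i) (τ t)
  p_mono i _ hs _ ht hst := tailProb_anti (D i) (hτ.antitoneOn hn hs ht hst)
  p_cont i := (continuous_tailProb (D i) (hD i)).continuousAt.comp_continuousWithinAt
    (hτ.continuousWithinAt_one hn)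
  prod_eq t ht := hτ.prod_eq hn ht
  q_eq i t _ := by
    have h := prob_exists_lt (D := D) (Finset.univ.erase i) (τ t)
    have e : {v : Fin n → ℝ | ∃ j ∈ Finset.univ.erase i, τ t < (v j : EReal)} =
        {v | ∃ j, j ≠ i ∧ τ t < (v j : EReal)} := by
      ext v; simp
    rw [e] at h
    change 1 - (Measure.pi D).real _ = _
    rw [h, sub_sub_cancel]
    rfl
  q_nonneg _ _ := measureReal_nonneg

end IsThreshold

theorem ExceedSystem.exists_eq_one {p q : Fin n → ℝ → ℝ} (h : ExceedSystem p q) :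
    ∃ i, p i 1 = 1 := by
  have h1 := h.prod_eq 1 (by simp)
  rw [sub_self, Finset.prod_eq_zero_iff] at h1
  obtain ⟨i, _, hi⟩ := h1
  exact ⟨i, by linarith⟩

end Product

/-! ### Arrival laws and acceptance probabilities. -/

/-- Under a product measure, the probability that the `i`th coordinate lies in `U` and all the
others lie in sets depending on the `i`th coordinate. -/
theorem pi_measure_dependent {n : ℕ} {Z : Type*} [MeasurableSpace Z] (μ : Fin n → Measure Z)
    [∀ i, IsProbabilityMeasure (μ i)] (i : Fin n) {U : Set Z} (hU : MeasurableSet U)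
    {V : Z → Set Z} (hV : MeasurableSet {z : Z × Z | z.2 ∈ V z.1}) :
    Measure.pi μ {ω | ω i ∈ U ∧ ∀ j, j ≠ i → ω j ∈ V (ω i)} =
      ∫⁻ z in U, ∏ j ∈ Finset.univ.erase i, μ j (V z) ∂μ i := by
  cases n with
  | zero => exact i.elim0
  | succ m =>
    set T : Set (Z × (Fin m → Z)) := {w | w.1 ∈ U ∧ ∀ k, w.2 k ∈ V w.1} with hT
    have hTm : MeasurableSet T := by
      refine (measurable_fst hU).inter ?_
      have : {w : Z × (Fin m → Z) | ∀ k, w.2 k ∈ V w.1} =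
          ⋂ k, (fun w : Z × (Fin m → Z) => (w.1, w.2 k)) ⁻¹' {z : Z × Z | z.2 ∈ V z.1} := by
        ext w; simp
      change MeasurableSet {w : Z × (Fin m → Z) | ∀ k, w.2 k ∈ V w.1}
      rw [this]
      exact MeasurableSet.iInter fun k =>
        (measurable_fst.prodMk ((measurable_pi_apply k).comp measurable_snd)) hV
    have hpre : {ω : Fin (m + 1) → Z | ω i ∈ U ∧ ∀ j, j ≠ i → ω j ∈ V (ω i)} =
        (MeasurableEquiv.piFinSuccAbove (fun _ => Z) i) ⁻¹' T := by
      ext ω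
      simp only [hT, mem_ofPred_eq, mem_preimage, MeasurableEquiv.piFinSuccAbove_apply,
        Fin.insertNthEquiv_symm_apply, Fin.removeNth]
      refine and_congr_right fun _ => ⟨fun h k => h _ (Fin.succAbove_ne i k), fun h j hj => ?_⟩
      obtain ⟨k, rfl⟩ := Fin.exists_succAbove_eq hj
      exact h k
    rw [hpre, (measurePreserving_piFinSuccAbove μ i).measure_preimage_equiv,
      Measure.prod_apply hTm, ← lintegral_indicator hU]
    refine lintegral_congr fun z => ?_
    by_cases hz : z ∈ U
    · have : Prod.mk z ⁻¹' T = Set.pi univ fun _ => V z := by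
        ext w
        simp [hT, hz]
      rw [this, Measure.pi_pi, indicator_of_mem hz]
      have he : Finset.univ.erase i = Finset.univ.image i.succAbove := by
        ext j
        simp
      rw [he, Finset.prod_image (Fin.succAbove_right_injective.injOn)]
    · have : Prod.mk z ⁻¹' T = ∅ := by
        ext w
        simp [hT, hz]
      rw [this, measure_empty, indicator_of_notMem hz]

section Arrival

variable {n : ℕ} {Γ : ℝ} {D : Fin n → Measure ℝ} {τ : ℝ → EReal}

theorem integral_Ico_eq_interval (f : ℝ → ℝ) :
    ∫ t in Ico (0 : ℝ) 1, f t = ∫ t in (0 : ℝ)..1, f t := by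
  rw [intervalIntegral.integral_of_le zero_le_one, integral_Ico_eq_integral_Ioo,
    integral_Ioc_eq_integral_Ioo]

theorem lintegral_Ico_ofReal {f : ℝ → ℝ} (hf : IntervalIntegrable f volume 0 1)
    (h0 : ∀ t ∈ Ico (0 : ℝ) 1, 0 ≤ f t) :
    ∫⁻ t in Ico (0 : ℝ) 1, ENNReal.ofReal (f t) = ENNReal.ofReal (∫ t in (0 : ℝ)..1, f t) := by
  rw [← integral_Ico_eq_interval, ofReal_integral_eq_lintegral_ofReal]
  · rwa [← IntegrableOn, ← intervalIntegrable_iff_integrableOn_Ico_of_le zero_le_one]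
  · exact (ae_restrict_iff' measurableSet_Ico).2 (Eventually.of_forall h0)

/-- What the analysis of the algorithm needs to know about the instance. -/
structure IsGoodInstance (Γ : ℝ) (D : Fin n → Measure ℝ) (τ : ℝ → EReal) : Prop where
  pos : 0 < Γ
  lt_one : Γ < 1
  anti : AntitoneOn τ (Icc (0 : ℝ) 1)
  system : ExceedSystem (exceedProb D τ) (othersProb D τ)
  barrier : ∃ B b, IsBarrier Γ B b

namespace IsGoodInstance

theorem intervalIntegrable_density (h : IsGoodInstance Γ D τ) (i : Fin n) :
    IntervalIntegrable (arrivalDensity Γ D τ i) volume 0 1 :=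
  h.system.dens_intervalIntegrable h.pos.le h.lt_one i (by simp) (by simp)

theorem density_nonneg (h : IsGoodInstance Γ D τ) (i : Fin n) {t : ℝ} (ht : t ∈ Ico (0 : ℝ) 1) :
    0 ≤ arrivalDensity Γ D τ i t :=
  h.system.dens_nonneg h.pos.le h.lt_one i ht

theorem integral_density_le (h : IsGoodInstance Γ D τ) (i : Fin n) :
    ∫ t in (0 : ℝ)..1, arrivalDensity Γ D τ i t ≤ 1 := by
  obtain ⟨B, b, hB⟩ := h.barrier
  exact h.system.integral_dens_le_one h.pos.le h.lt_one hB i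

theorem isProbabilityMeasure_arrivalLaw (h : IsGoodInstance Γ D τ) (i : Fin n) :
    IsProbabilityMeasure (arrivalLaw Γ D τ i) := by
  constructor
  have h0 : 0 ≤ ∫ t in (0 : ℝ)..1, arrivalDensity Γ D τ i t := by
    rw [← integral_Ico_eq_interval]
    exact setIntegral_nonneg measurableSet_Ico fun t ht => h.density_nonneg i ht
  rw [arrivalLaw, Measure.add_apply, withDensity_apply _ MeasurableSet.univ,
    Measure.restrict_univ, lintegral_Ico_ofReal (h.intervalIntegrable_density i)
      fun t ht => h.density_nonneg i ht, integral_Ico_eq_interval, Measure.smul_apply,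
    measure_univ, smul_eq_mul, mul_one, ← ENNReal.ofReal_add h0
      (sub_nonneg.2 (h.integral_density_le i))]
  simp

theorem lintegral_arrivalLaw (h : IsGoodInstance Γ D τ) (i : Fin n) {φ : ℝ → ENNReal}
    (hφ : Measurable φ) :
    ∫⁻ t, φ t ∂arrivalLaw Γ D τ i =
      (∫⁻ t in Ico (0 : ℝ) 1, ENNReal.ofReal (arrivalDensity Γ D τ i t) * φ t) +
      ENNReal.ofReal (1 - ∫ t in (0 : ℝ)..1, arrivalDensity Γ D τ i t) * φ 1 := by
  have hm : AEMeasurable (fun t => ENNReal.ofReal (arrivalDensity Γ D τ i t))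
      (volume.restrict (Ico (0 : ℝ) 1)) := by
    have := h.intervalIntegrable_density i
    rw [intervalIntegrable_iff_integrableOn_Ico_of_le zero_le_one] at this
    exact this.aemeasurable.ennreal_ofReal
  rw [arrivalLaw, lintegral_add_measure, lintegral_withDensity_eq_lintegral_mul₀ hm
    hφ.aemeasurable, lintegral_smul_measure, lintegral_dirac' _ hφ, integral_Ico_eq_interval]
  rfl

end IsGoodInstance

/-- The value-time pairs that would be accepted at some time before `1`. -/
def goodPairs (τ : ℝ → EReal) : Set (ℝ × ℝ) :=
  {z | z.2 ∈ Ico (0 : ℝ) 1 ∧ τ z.2 < (z.1 : EReal)}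

/-- The pairs for which item `i` is acceptable with a value exceeding `y`. -/
def acceptPairs (τ : ℝ → EReal) (i₁ : Fin n) (y : EReal) (i : Fin n) : Set (ℝ × ℝ) :=
  {z | (z ∈ goodPairs τ ∨ (i = i₁ ∧ z.2 = 1)) ∧ y < (z.1 : EReal)}

/-- The event that item `i` is acceptable with a value exceeding `y` and that no other item is
acceptable at the same time or before. -/
def firstEvent (τ : ℝ → EReal) (i₁ : Fin n) (y : EReal) (i : Fin n) : Set (Fin n → ℝ × ℝ) :=
  {ω | ω i ∈ acceptPairs τ i₁ y i ∧ ∀ j, j ≠ i → ω j ∈ {z | z ∈ goodPairs τ ∧ z.2 ≤ (ω i).2}ᶜ}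

theorem measurableSet_goodPairs (hτ : AntitoneOn τ (Icc (0 : ℝ) 1)) :
    MeasurableSet (goodPairs τ) := by
  -- Precomposition with the clamp makes τ antitone on the whole line, hence measurable.
  have hm : Measurable fun s => τ (clampUnit s) := by
    refine Antitone.measurable fun s t hst => ?_
    exact hτ (clampUnit_mem s) (clampUnit_mem t)
      (max_le_max le_rfl (min_le_min hst le_rfl))
  have e : goodPairs τ = Prod.snd ⁻¹' Ico (0 : ℝ) 1 ∩
      {z : ℝ × ℝ | τ (clampUnit z.2) < (z.1 : EReal)} := by
    ext z
    refine and_congr_right fun hz => ?_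
    rw [mem_ofPred_eq, clampUnit_of_mem (Ico_subset_Icc_self hz)]
  rw [e]
  exact (measurable_snd measurableSet_Ico).inter (measurableSet_lt (hm.comp measurable_snd)
    (measurable_coe_real_ereal.comp measurable_fst))

theorem measurableSet_acceptPairs (hτ : AntitoneOn τ (Icc (0 : ℝ) 1)) (i₁ : Fin n) (y : EReal)
    (i : Fin n) : MeasurableSet (acceptPairs τ i₁ y i) := by
  refine MeasurableSet.inter ((measurableSet_goodPairs hτ).union ?_) ?_
  · exact (MeasurableSet.const _).inter (measurable_snd (measurableSet_singleton 1))
  · exact measurable_fst (measurableSet_lt_coe y)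

theorem measurableSet_earlier (hτ : AntitoneOn τ (Icc (0 : ℝ) 1)) :
    MeasurableSet {w : (ℝ × ℝ) × (ℝ × ℝ) | w.2 ∈ {z | z ∈ goodPairs τ ∧ z.2 ≤ w.1.2}ᶜ} := by
  have : MeasurableSet {w : (ℝ × ℝ) × (ℝ × ℝ) | w.2 ∈ goodPairs τ ∧ w.2.2 ≤ w.1.2} :=
    (measurable_snd (measurableSet_goodPairs hτ)).inter
      (measurableSet_le (measurable_snd.comp measurable_snd) (measurable_snd.comp measurable_fst))
  exact this.compl

namespace IsGoodInstance

variable [∀ i, IsProbabilityMeasure (D i)]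

/-- An arrival of j at time r < 1 is acceptable with probability p_j(r), so the complement has mass
∫₀ˢ f_j p_j = 1 - S_j(s). The atom at time 1 does not count, because `goodPairs` requires a time
below 1. -/
theorem measure_earlier (h : IsGoodInstance Γ D τ) (j : Fin n) {s : ℝ} (hs : s ∈ Icc (0 : ℝ) 1) :
    ((D j).prod (arrivalLaw Γ D τ j)) {z | z ∈ goodPairs τ ∧ z.2 ≤ s}ᶜ =
      ENNReal.ofReal (surv Γ (exceedProb D τ) (othersProb D τ) j s) := by
  have := h.isProbabilityMeasure_arrivalLaw j
  have hm : MeasurableSet {z : ℝ × ℝ | z ∈ goodPairs τ ∧ z.2 ≤ s} :=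
    (measurableSet_goodPairs h.anti).inter (measurableSet_le measurable_snd measurable_const)
  have key : ((D j).prod (arrivalLaw Γ D τ j)) {z | z ∈ goodPairs τ ∧ z.2 ≤ s} =
      ENNReal.ofReal (1 - surv Γ (exceedProb D τ) (othersProb D τ) j s) := by
    rw [Measure.prod_apply_symm hm, h.lintegral_arrivalLaw j (measurable_measure_prodMk_right hm)]
    have h1 : (fun x : ℝ => (x, (1 : ℝ))) ⁻¹' {z | z ∈ goodPairs τ ∧ z.2 ≤ s} = ∅ := by
      ext x
      simp [goodPairs]
    rw [h1, measure_empty, mul_zero, add_zero, ← h.system.integral_dens_mul_p h.pos.le h.lt_one j hs,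
      ← intervalIntegral.integral_indicator hs]
    have hi : IntervalIntegrable (fun t => dens Γ (exceedProb D τ) (othersProb D τ) j t *
        exceedProb D τ j t) volume 0 1 :=
      (h.intervalIntegrable_density j).mul_continuousOn
        (by rw [uIcc_of_le zero_le_one]; exact h.system.p_continuousOn j)
    have hnn : ∀ t ∈ Ico (0 : ℝ) 1, 0 ≤ dens Γ (exceedProb D τ) (othersProb D τ) j t *
        exceedProb D τ j t := fun t ht => mul_nonneg (h.density_nonneg j ht) measureReal_nonneg
    rw [← lintegral_Ico_ofReal]
    · refine setLIntegral_congr_fun measurableSet_Ico fun t ht => ?_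
      by_cases hts : t ≤ s
      · have e : (fun x : ℝ => (x, t)) ⁻¹' {z | z ∈ goodPairs τ ∧ z.2 ≤ s} =
            {x : ℝ | τ t < (x : EReal)} := by
          ext x
          simp [goodPairs, ht.1, ht.2, hts]
        simp only [e]
        rw [indicator_of_mem (by exact hts), ENNReal.ofReal_mul
          (h.system.dens_nonneg h.pos.le h.lt_one j ht)]
        rw [exceedProb, ofReal_measureReal]
        rfl
      · have e : (fun x : ℝ => (x, t)) ⁻¹' {z | z ∈ goodPairs τ ∧ z.2 ≤ s} = ∅ := by
          ext x
          simp [hts]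
        simp only [e]
        rw [indicator_of_notMem (by exact hts)]
        simp
    · rw [intervalIntegrable_iff_integrableOn_Ico_of_le zero_le_one] at hi ⊢
      exact hi.indicator measurableSet_Iic
    · exact fun t ht => indicator_apply_nonneg fun _ => hnn t ht
  have hle : surv Γ (exceedProb D τ) (othersProb D τ) j s ≤ 1 := by
    have h1 := h.system.integral_dens_mul_p h.pos.le h.lt_one j hs
    have h2 : 0 ≤ ∫ t in (0 : ℝ)..s, dens Γ (exceedProb D τ) (othersProb D τ) j t *
        exceedProb D τ j t := by
      rw [intervalIntegral.integral_of_le hs.1, integral_Ioc_eq_integral_Ioo]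
      exact setIntegral_nonneg measurableSet_Ioo fun t ht => mul_nonneg
        (h.density_nonneg j ⟨ht.1.le, ht.2.trans_le hs.2⟩) measureReal_nonneg
    linarith
  rw [prob_compl_eq_one_sub hm, key, ← ENNReal.ofReal_one, ← ENNReal.ofReal_sub]
  · simp
  · linarith

end IsGoodInstance

end Arrival

section Acceptance

variable {n : ℕ} {Γ : ℝ} {D : Fin n → Measure ℝ} {τ : ℝ → EReal}

theorem ExceedSystem.integral_min {p q : Fin n → ℝ → ℝ} (h : ExceedSystem p q) (i : Fin n)
    {t : ℝ} (ht : t ∈ Icc (0 : ℝ) 1) :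
    IntervalIntegrable (fun s => deriv (q i) s * p i (min s t)) volume 0 1 ∧
    ∫ s in (0 : ℝ)..1, deriv (q i) s * p i (min s t) =
      (∫ s in (0 : ℝ)..t, deriv (q i) s * p i s) + (q i 1 - q i t) * p i t := by
  have h0 : (0 : ℝ) ∈ Icc (0 : ℝ) 1 := by simp
  have h1 : (1 : ℝ) ∈ Icc (0 : ℝ) 1 := by simp
  have hc : ContinuousOn (fun s => p i (min s t)) (Icc (0 : ℝ) 1) :=
    (h.p_continuousOn i).comp (by fun_prop) fun s hs =>
      ⟨le_min hs.1 ht.1, (min_le_left _ _).trans hs.2⟩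
  have hI : ∀ {a b : ℝ}, a ∈ Icc (0 : ℝ) 1 → b ∈ Icc (0 : ℝ) 1 →
      IntervalIntegrable (fun s => deriv (q i) s * p i (min s t)) volume a b := fun ha hb =>
    h.intervalIntegrable_mul i hc ha hb
  refine ⟨hI h0 h1, ?_⟩
  rw [← intervalIntegral.integral_add_adjacent_intervals (hI h0 ht) (hI ht h1)]
  congr 1
  · refine intervalIntegral.integral_congr fun s hs => ?_
    rw [uIcc_of_le ht.1] at hs
    simp only [min_eq_left hs.2]
  · have hq : AbsolutelyContinuousOnInterval (q i) t 1 := (h.q_ac i).mono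
      (by rw [uIcc_of_le ht.2, uIcc_of_le zero_le_one]; exact Icc_subset_Icc_left ht.1)
    rw [← hq.integral_deriv_eq_sub, ← intervalIntegral.integral_mul_const]
    refine intervalIntegral.integral_congr fun s hs => ?_
    rw [uIcc_of_le ht.2] at hs
    simp only [min_eq_right hs.1]

theorem ofReal_sum_le {ι : Type*} (s : Finset ι) (f : ι → ℝ) :
    ENNReal.ofReal (∑ i ∈ s, f i) ≤ ∑ i ∈ s, ENNReal.ofReal (f i) := by
  classical
  induction s using Finset.induction_on with
  | empty => simp
  | insert i s hi ih =>
    rw [Finset.sum_insert hi, Finset.sum_insert hi]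
    exact ENNReal.ofReal_add_le.trans (add_le_add le_rfl ih)

namespace IsGoodInstance

variable [∀ i, IsProbabilityMeasure (D i)]

/-- The joint law of the values and arrival times, item by item. -/
noncomputable def _root_.OrderSelection.itemLaw (Γ : ℝ) (D : Fin n → Measure ℝ) (τ : ℝ → EReal)
    (i : Fin n) : Measure (ℝ × ℝ) := (D i).prod (arrivalLaw Γ D τ i)

theorem isProbabilityMeasure_itemLaw (h : IsGoodInstance Γ D τ) (i : Fin n) :
    IsProbabilityMeasure (itemLaw Γ D τ i) := by
  have := h.isProbabilityMeasure_arrivalLaw i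
  unfold itemLaw
  infer_instance

/-- Conditionally on the arrival time s of item i, the others are independent and each avoids
earlier acceptability with probability S_j(s). The second summand is the atom at time 1. -/
theorem measure_firstEvent (h : IsGoodInstance Γ D τ) (i₁ i : Fin n) (y : EReal) :
    Measure.pi (itemLaw Γ D τ) (firstEvent τ i₁ y i) =
      (∫⁻ s in Ico (0 : ℝ) 1, ENNReal.ofReal (arrivalDensity Γ D τ i s) *
        (ENNReal.ofReal (∏ j ∈ Finset.univ.erase i,
          surv Γ (exceedProb D τ) (othersProb D τ) j (clampUnit s)) *
          D i ((fun x => (x, s)) ⁻¹' acceptPairs τ i₁ y i))) +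
      ENNReal.ofReal (1 - ∫ s in (0 : ℝ)..1, arrivalDensity Γ D τ i s) *
        (ENNReal.ofReal (∏ j ∈ Finset.univ.erase i,
          surv Γ (exceedProb D τ) (othersProb D τ) j (clampUnit 1)) *
          D i ((fun x => (x, (1 : ℝ))) ⁻¹' acceptPairs τ i₁ y i)) := by
  have hp := h.isProbabilityMeasure_itemLaw
  have hF := h.isProbabilityMeasure_arrivalLaw
  have hA := measurableSet_acceptPairs h.anti i₁ y i
  have hφ : Measurable fun s => ENNReal.ofReal (∏ j ∈ Finset.univ.erase i,
      surv Γ (exceedProb D τ) (othersProb D τ) j (clampUnit s)) := by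
    refine Measurable.ennreal_ofReal (Continuous.measurable ?_)
    exact continuous_finsetProd _ fun j _ => (h.system.surv_continuousOn h.pos.le h.lt_one
      j).comp_continuous continuous_clampUnit clampUnit_mem
  have hsec : Measurable fun s => D i ((fun x => (x, s)) ⁻¹' acceptPairs τ i₁ y i) :=
    measurable_measure_prodMk_right hA
  refine Eq.trans ?_ (h.lintegral_arrivalLaw i (hφ.mul hsec))
  rw [firstEvent,
    pi_measure_dependent (itemLaw Γ D τ) i hA (V := fun z => {w | w ∈ goodPairs τ ∧ w.2 ≤ z.2}ᶜ)
      (measurableSet_earlier h.anti)]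
  have e1 : ∫⁻ z in acceptPairs τ i₁ y i, ∏ j ∈ Finset.univ.erase i,
      itemLaw Γ D τ j {w | w ∈ goodPairs τ ∧ w.2 ≤ z.2}ᶜ ∂itemLaw Γ D τ i =
      ∫⁻ z in acceptPairs τ i₁ y i, ENNReal.ofReal (∏ j ∈ Finset.univ.erase i,
        surv Γ (exceedProb D τ) (othersProb D τ) j (clampUnit z.2)) ∂itemLaw Γ D τ i := by
    refine setLIntegral_congr_fun hA fun z hz => ?_
    have hz2 : z.2 ∈ Icc (0 : ℝ) 1 := by
      rcases hz.1 with hg | ⟨_, h1⟩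
      · exact Ico_subset_Icc_self hg.1
      · simp [h1]
    simp only [clampUnit_of_mem hz2]
    rw [ENNReal.ofReal_prod_of_nonneg fun j _ => (surv_pos _ _ _ _ _).le]
    exact Finset.prod_congr rfl fun j _ => h.measure_earlier j hz2
  have hφ2 : Measurable fun z : ℝ × ℝ => ENNReal.ofReal (∏ j ∈ Finset.univ.erase i,
      surv Γ (exceedProb D τ) (othersProb D τ) j (clampUnit z.2)) := hφ.comp measurable_snd
  rw [e1, ← lintegral_indicator hA, itemLaw, lintegral_prod_symm' _ (hφ2.indicator hA)]
  refine lintegral_congr fun s => ?_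
  have e2 : ∀ x : ℝ, (acceptPairs τ i₁ y i).indicator (fun z => ENNReal.ofReal
      (∏ j ∈ Finset.univ.erase i,
        surv Γ (exceedProb D τ) (othersProb D τ) j (clampUnit z.2))) (x, s) =
      ((fun x => (x, s)) ⁻¹' acceptPairs τ i₁ y i).indicator (fun _ => ENNReal.ofReal
      (∏ j ∈ Finset.univ.erase i,
        surv Γ (exceedProb D τ) (othersProb D τ) j (clampUnit s))) x := fun x => rfl
  simp only [e2]
  rw [lintegral_indicator_const (measurable_prodMk_right hA)]

/-- At time s the value has to exceed both τ(s) and y. Whichever is larger, this is at least as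
likely as exceeding the threshold of min(s, t). -/
theorem le_measure_section (h : IsGoodInstance Γ D τ) (i₁ i : Fin n) {y : EReal} {t : ℝ}
    (ht : t ∈ Icc (0 : ℝ) 1) (hy : exceedProb D τ i t ≤ tailProb (D i) y) {s : ℝ}
    (hs : s ∈ Ico (0 : ℝ) 1) :
    ENNReal.ofReal (exceedProb D τ i (min s t)) ≤
      D i ((fun x => (x, s)) ⁻¹' acceptPairs τ i₁ y i) := by
  have hs' := Ico_subset_Icc_self hs
  have hm : min s t ∈ Icc (0 : ℝ) 1 := ⟨le_min hs.1 ht.1, (min_le_left _ _).trans hs'.2⟩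
  have hsub : {x : ℝ | max (τ s) y < (x : EReal)} ⊆
      (fun x => (x, s)) ⁻¹' acceptPairs τ i₁ y i := fun x hx =>
    ⟨Or.inl ⟨hs, (le_max_left _ _).trans_lt hx⟩, (le_max_right _ _).trans_lt hx⟩
  refine le_trans ?_ (measure_mono hsub)
  have hle : exceedProb D τ i (min s t) ≤ tailProb (D i) (max (τ s) y) := by
    rcases le_total (τ s) y with hc | hc
    · rw [max_eq_right hc]
      exact (h.system.p_mono i hm ht (min_le_right _ _)).trans hy
    · rw [max_eq_left hc]
      exact h.system.p_mono i hm hs' (min_le_left _ _)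
  refine (ENNReal.ofReal_le_ofReal hle).trans ?_
  rw [tailProb, ofReal_measureReal]

theorem le_measure_firstEvent (h : IsGoodInstance Γ D τ) (i₁ i : Fin n) {y : EReal} {t : ℝ}
    (ht : t ∈ Icc (0 : ℝ) 1) (hy : exceedProb D τ i t ≤ tailProb (D i) y) :
    ENNReal.ofReal (Γ * ((∫ s in (0 : ℝ)..t, deriv (othersProb D τ i) s * exceedProb D τ i s) +
        (othersProb D τ i 1 - othersProb D τ i t) * exceedProb D τ i t) +
      if i = i₁ then (1 - ∫ s in (0 : ℝ)..1, arrivalDensity Γ D τ i s) *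
        (∏ j ∈ Finset.univ.erase i, surv Γ (exceedProb D τ) (othersProb D τ) j 1) *
        exceedProb D τ i t else 0) ≤
      Measure.pi (itemLaw Γ D τ) (firstEvent τ i₁ y i) := by
  rw [h.measure_firstEvent]
  refine ENNReal.ofReal_add_le.trans (add_le_add ?_ ?_)
  · obtain ⟨hI, e⟩ := h.system.integral_min i ht
    rw [← e, ← intervalIntegral.integral_const_mul, ← lintegral_Ico_ofReal (hI.const_mul Γ)]
    · refine setLIntegral_mono' measurableSet_Ico fun s hs => ?_
      have hs' := Ico_subset_Icc_self hs
      rw [clampUnit_of_mem hs', ← mul_assoc, ← mul_assoc,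
        ← h.system.dens_mul_prod_surv h.pos.le h.lt_one i hs',
        ENNReal.ofReal_mul (mul_nonneg (h.system.dens_nonneg h.pos.le h.lt_one i hs)
          (Finset.prod_nonneg fun j _ => (surv_pos _ _ _ _ _).le)),
        ENNReal.ofReal_mul (h.system.dens_nonneg h.pos.le h.lt_one i hs)]
      exact mul_le_mul_right (h.le_measure_section i₁ i ht hy hs) _
    · intro s hs
      exact mul_nonneg h.pos.le (mul_nonneg (h.system.deriv_q_nonneg i hs) measureReal_nonneg)
  · split_ifs with hi
    · have h1 : 0 ≤ 1 - ∫ s in (0 : ℝ)..1, arrivalDensity Γ D τ i s :=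
        sub_nonneg.2 (h.integral_density_le i)
      have h2 : 0 ≤ ∏ j ∈ Finset.univ.erase i, surv Γ (exceedProb D τ) (othersProb D τ) j 1 :=
        Finset.prod_nonneg fun j _ => (surv_pos _ _ _ _ _).le
      rw [clampUnit_of_mem (by simp), ENNReal.ofReal_mul (mul_nonneg h1 h2),
        ENNReal.ofReal_mul h1, mul_assoc]
      refine mul_le_mul_right (mul_le_mul_right ?_ _) _
      have hsub : {x : ℝ | y < (x : EReal)} ⊆
          (fun x => (x, (1 : ℝ))) ⁻¹' acceptPairs τ i₁ y i := fun x hx =>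
        ⟨Or.inr ⟨hi, rfl⟩, hx⟩
      refine le_trans ?_ (measure_mono hsub)
      refine (ENNReal.ofReal_le_ofReal hy).trans ?_
      rw [tailProb, ofReal_measureReal]
    · simp

/-- The events that an item with a value exceeding `y` is accepted have total probability at
least `Γ t`, if `y` is no more selective than the threshold of time `t`. -/
theorem le_sum_measure_firstEvent (h : IsGoodInstance Γ D τ) {i₁ : Fin n}
    (hi₁ : exceedProb D τ i₁ 1 = 1) {y : EReal} {t : ℝ} (ht : t ∈ Icc (0 : ℝ) 1)
    (hy : ∀ i, exceedProb D τ i t ≤ tailProb (D i) y) :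
    ENNReal.ofReal (Γ * t) ≤ ∑ i, Measure.pi (itemLaw Γ D τ) (firstEvent τ i₁ y i) := by
  obtain ⟨B, b, hB⟩ := h.barrier
  refine le_trans ?_ (Finset.sum_le_sum fun i _ => h.le_measure_firstEvent i₁ i ht (hy i))
  refine le_trans (ENNReal.ofReal_le_ofReal ?_) (ofReal_sum_le _ _)
  rw [Finset.sum_add_distrib, Finset.sum_ite_eq' Finset.univ i₁ _, if_pos (Finset.mem_univ i₁)]
  exact h.system.le_total h.pos.le h.lt_one hB hi₁ ht

end IsGoodInstance

theorem Accepts.eq_of_accepts {i₁ : Fin n} {v t : Fin n → ℝ} {i j : Fin n}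
    (hi : Accepts τ i₁ v t i) (hj : Accepts τ i₁ v t j) : i = j := by
  by_contra hne
  rcases hi.2 j (Ne.symm hne) hj.1 with h1 | ⟨h1, h1'⟩ <;>
    rcases hj.2 i hne hi.1 with h2 | ⟨h2, h2'⟩
  · exact lt_asymm h1 h2
  · exact h1.ne h2.symm
  · exact h2.ne h1.symm
  · exact lt_asymm h1' h2'

theorem Accepts.algValue_eq {i₁ : Fin n} {v t : Fin n → ℝ} {i : Fin n}
    (hi : Accepts τ i₁ v t i) : algValue τ i₁ v t = v i := by
  classical
  unfold algValue
  rw [Finset.sum_eq_single i (fun j _ hj => if_neg fun h => hj (h.eq_of_accepts hi)) (by simp),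
    if_pos hi]

/-- `firstEvent` excludes ties in favour of i, so the tie-breaking rule plays no role. At time 1
only i₁ is acceptable. -/
theorem accepts_of_mem_firstEvent {i₁ : Fin n} {y : EReal} {i : Fin n} {ω : Fin n → ℝ × ℝ}
    (h : ω ∈ firstEvent τ i₁ y i) :
    Accepts τ i₁ (fun j => (ω j).1) (fun j => (ω j).2) i := by
  obtain ⟨⟨hacc, -⟩, hother⟩ := h
  refine ⟨hacc, fun j hj hjacc => Or.inl ?_⟩
  rcases hjacc with hg | ⟨rfl, hj1⟩
  · by_contra hneg
    exact hother j hj ⟨hg, not_lt.1 hneg⟩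
  · rcases hacc with hg | ⟨rfl, -⟩
    · rw [hj1]
      exact hg.1.2
    · exact absurd rfl hj

theorem pairwiseDisjoint_firstEvent (i₁ : Fin n) (y : EReal) :
    Pairwise (Function.onFun Disjoint (firstEvent τ i₁ y)) := fun _ _ hij =>
  Set.disjoint_left.2 fun _ h h' =>
    hij ((accepts_of_mem_firstEvent h).eq_of_accepts (accepts_of_mem_firstEvent h'))

theorem measurableSet_firstEvent (hτ : AntitoneOn τ (Icc (0 : ℝ) 1)) (i₁ : Fin n) (y : EReal)
    (i : Fin n) : MeasurableSet (firstEvent τ i₁ y i) := by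
  have hi : MeasurableSet ((fun ω : Fin n → ℝ × ℝ => ω i) ⁻¹' acceptPairs τ i₁ y i) :=
    measurable_pi_apply i (measurableSet_acceptPairs hτ i₁ y i)
  refine MeasurableSet.inter hi ?_
  have : {ω : Fin n → ℝ × ℝ | ∀ j, j ≠ i → ω j ∈ {z | z ∈ goodPairs τ ∧ z.2 ≤ (ω i).2}ᶜ} =
      ⋂ j, ⋂ (_ : j ≠ i), (fun ω : Fin n → ℝ × ℝ => (ω i, ω j)) ⁻¹'
        {w | w.2 ∈ {z | z ∈ goodPairs τ ∧ z.2 ≤ w.1.2}ᶜ} := by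
    ext ω
    simp only [mem_iInter]
    rfl
  change MeasurableSet {ω : Fin n → ℝ × ℝ |
    ∀ j, j ≠ i → ω j ∈ {z | z ∈ goodPairs τ ∧ z.2 ≤ (ω i).2}ᶜ}
  rw [this]
  exact MeasurableSet.iInter fun j => MeasurableSet.iInter fun _ =>
    ((measurable_pi_apply i).prodMk (measurable_pi_apply j)) (measurableSet_earlier hτ)

theorem firstEvent_eq (i₁ : Fin n) (y : EReal) (i : Fin n) :
    firstEvent τ i₁ y i = {ω | y < ((ω i).1 : EReal)} ∩ firstEvent τ i₁ ⊥ i := by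
  ext ω
  simp only [firstEvent, acceptPairs, mem_inter_iff, mem_ofPred_eq, EReal.bot_lt_coe, and_true]
  tauto

/-- If factors are dominated one by one and the products agree and are positive, no factor can be
strictly smaller. -/
theorem eq_of_prod_eq {ι : Type*} [DecidableEq ι] {s : Finset ι} {a b : ι → ℝ}
    (ha : ∀ j ∈ s, 0 ≤ a j) (hab : ∀ j ∈ s, a j ≤ b j) (hpos : 0 < ∏ j ∈ s, a j)
    (heq : ∏ j ∈ s, a j = ∏ j ∈ s, b j) {i : ι} (hi : i ∈ s) : b i ≤ a i := by
  rw [← Finset.mul_prod_erase s a hi] at hpos heq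
  rw [← Finset.mul_prod_erase s b hi] at heq
  have hP : 0 < ∏ j ∈ s.erase i, a j := by
    by_contra hneg
    nlinarith [ha i hi, mul_nonneg (ha i hi) (neg_nonneg.2 (not_lt.1 hneg))]
  have hle : ∏ j ∈ s.erase i, a j ≤ ∏ j ∈ s.erase i, b j :=
    Finset.prod_le_prod (fun j hj => ha j (Finset.mem_of_mem_erase hj))
      fun j hj => hab j (Finset.mem_of_mem_erase hj)
  have hb : 0 ≤ b i := (ha i hi).trans (hab i hi)
  refine le_of_mul_le_mul_right ?_ hP
  rw [heq]
  exact mul_le_mul_of_nonneg_left hle hb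

theorem lintegral_ofReal_eq_lintegral_meas_lt {Ω : Type*} [MeasurableSpace Ω] (μ : Measure Ω)
    {f : Ω → ℝ} (hf : AEMeasurable f μ) :
    ∫⁻ ω, ENNReal.ofReal (f ω) ∂μ = ∫⁻ x in Ioi (0 : ℝ), μ {ω | x < f ω} := by
  have h := lintegral_eq_lintegral_meas_lt μ (f := fun ω => max (f ω) 0)
    (Eventually.of_forall fun ω => le_max_right _ _) (hf.max aemeasurable_const)
  have e : ∀ ω, ENNReal.ofReal (max (f ω) 0) = ENNReal.ofReal (f ω) := fun ω => by
    rcases le_total (f ω) 0 with h | h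
    · rw [max_eq_right h, ENNReal.ofReal_zero, ENNReal.ofReal_of_nonpos h]
    · rw [max_eq_left h]
  simp only [e] at h
  rw [h]
  refine setLIntegral_congr_fun measurableSet_Ioi fun x hx => ?_
  congr 1
  ext ω
  simp [(show (0 : ℝ) < x from hx).not_gt]

/-! ### The guarantees in probability and in expectation. -/

section Final

variable [∀ i, IsProbabilityMeasure (D i)]

/-- A level `y` is no more selective for any item than the threshold that the largest value
exceeds with the same probability. -/
theorem IsThreshold.exceedProb_le_tailProb (hτ : IsThreshold D τ) (hn : 1 ≤ n) (y : EReal)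
    (i : Fin n) :
    exceedProb D τ i ((Measure.pi D).real {v | y < (maxVal v : EReal)}) ≤ tailProb (D i) y := by
  set t := (Measure.pi D).real {v | y < (maxVal v : EReal)} with ht
  have htm : t ∈ Icc (0 : ℝ) 1 := ⟨measureReal_nonneg, measureReal_le_one⟩
  rcases le_total y (τ t) with hc | hc
  · exact tailProb_anti (D i) hc
  -- Now y ≥ τ(t), and both have exceedance probability t. For t = 1 the maximality of τ(1) gives y
  -- ≤ τ(1); for t < 1 the products ∏ (1 - tail) are equal and positive, so the individual tails
  -- agree.
  · rcases eq_or_lt_of_le htm.2 with h1 | h1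
    · rw [h1]
      exact tailProb_anti (D i) (hτ.greatest_one y h1)
    · have e1 := hτ.prod_eq hn htm
      have e2 : ∏ j, (1 - tailProb (D j) y) = 1 - t := by
        rw [ht, prob_lt_maxVal hn]
        ring
      have := eq_of_prod_eq (s := Finset.univ) (a := fun j => 1 - tailProb (D j) (τ t))
        (b := fun j => 1 - tailProb (D j) y) (fun j _ => sub_nonneg.2 (tailProb_mem _ _).2)
        (fun j _ => sub_le_sub_left (tailProb_anti (D j) hc) _) (by rw [e1]; linarith)
        (e1.trans e2.symm) (Finset.mem_univ i)
      simp only [sub_le_sub_iff_left] at this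
      exact this

/-- The law of a run, with values and times listed item by item. -/
theorem IsGoodInstance.measurePreserving_run (h : IsGoodInstance Γ D τ) :
    MeasurePreserving (MeasurableEquiv.arrowProdEquivProdArrow ℝ ℝ (Fin n))
      (Measure.pi (itemLaw Γ D τ)) (runLaw Γ D τ) := by
  have := h.isProbabilityMeasure_arrivalLaw
  exact measurePreserving_arrowProdEquivProdArrow ℝ ℝ (Fin n) D (arrivalLaw Γ D τ)

theorem IsGoodInstance.prob_algValue (h : IsGoodInstance Γ D τ)
    {i₁ : Fin n} (hi₁ : exceedProb D τ i₁ 1 = 1) {t : ℝ} (ht : t ∈ Icc (0 : ℝ) 1) :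
    Γ * t ≤ (runLaw Γ D τ).real {ω | τ t < (algValue τ i₁ ω.1 ω.2 : EReal)} := by
  have hF := h.isProbabilityMeasure_arrivalLaw
  have hprob : IsProbabilityMeasure (runLaw Γ D τ) := by unfold runLaw; infer_instance
  have h1 := h.le_sum_measure_firstEvent hi₁ ht (y := τ t) fun i => le_rfl
  have hU : Measure.pi (itemLaw Γ D τ) (⋃ i, firstEvent τ i₁ (τ t) i) =
      ∑ i, Measure.pi (itemLaw Γ D τ) (firstEvent τ i₁ (τ t) i) := by
    rw [measure_iUnion (pairwiseDisjoint_firstEvent i₁ (τ t))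
      fun i => measurableSet_firstEvent h.anti i₁ (τ t) i, tsum_fintype]
  rw [← hU] at h1
  rw [measureReal_def, ← ENNReal.ofReal_le_iff_le_toReal (measure_ne_top _ _)]
  refine h1.trans ?_
  rw [← h.measurePreserving_run.measure_preimage_equiv]
  refine measure_mono (iUnion_subset fun i ω hω => ?_)
  have hv := (accepts_of_mem_firstEvent hω).algValue_eq
  change τ t < (algValue τ i₁ (fun j => (ω j).1) (fun j => (ω j).2) : EReal)
  rw [hv]
  exact hω.1.2

theorem IsGoodInstance.expectation_algValue (h : IsGoodInstance Γ D τ) (hτ : IsThreshold D τ)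
    (hn : 1 ≤ n) {i₁ : Fin n} (hi₁ : exceedProb D τ i₁ 1 = 1) :
    ENNReal.ofReal Γ * (∫⁻ v, ENNReal.ofReal (maxVal v) ∂(Measure.pi D)) ≤
      ∫⁻ ω, ENNReal.ofReal (algValue τ i₁ ω.1 ω.2) ∂(runLaw Γ D τ) := by
  have hp := h.isProbabilityMeasure_itemLaw
  have hmax : Measurable fun v : Fin n → ℝ => maxVal v :=
    Measurable.iSup fun i => measurable_pi_apply i
  have hmeas : ∀ i, Measurable fun ω : Fin n → ℝ × ℝ => (ω i).1 := fun i =>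
    measurable_fst.comp (measurable_pi_apply i)
  set P := Measure.pi (itemLaw Γ D τ) with hP
  have hE := fun i => measurableSet_firstEvent (n := n) h.anti i₁ ⊥ i
  -- On these disjoint measurable events the accepted value is a coordinate, so measurability of
  -- `algValue` itself is never needed.
  have step1 : ∑ i, ∫⁻ ω in firstEvent τ i₁ ⊥ i, ENNReal.ofReal (ω i).1 ∂P ≤
      ∫⁻ ω, ENNReal.ofReal (algValue τ i₁ ω.1 ω.2) ∂(runLaw Γ D τ) := by
    rw [← h.measurePreserving_run.map_eq, lintegral_map_equiv]
    calc ∑ i, ∫⁻ ω in firstEvent τ i₁ ⊥ i, ENNReal.ofReal (ω i).1 ∂P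
        = ∑ i, ∫⁻ ω in firstEvent τ i₁ ⊥ i, ENNReal.ofReal
            (algValue τ i₁ (fun j => (ω j).1) fun j => (ω j).2) ∂P := by
          refine Finset.sum_congr rfl fun i _ => setLIntegral_congr_fun (hE i) fun ω hω => ?_
          simp only [(accepts_of_mem_firstEvent hω).algValue_eq]
      _ = ∫⁻ ω in ⋃ i, firstEvent τ i₁ ⊥ i, ENNReal.ofReal
            (algValue τ i₁ (fun j => (ω j).1) fun j => (ω j).2) ∂P := by
          rw [lintegral_iUnion hE (pairwiseDisjoint_firstEvent i₁ ⊥), tsum_fintype]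
      _ ≤ _ := setLIntegral_le_lintegral _ _
  refine le_trans ?_ step1
  have step2 : ∀ i, ∫⁻ ω in firstEvent τ i₁ ⊥ i, ENNReal.ofReal (ω i).1 ∂P =
      ∫⁻ x in Ioi (0 : ℝ), P (firstEvent τ i₁ (x : EReal) i) := fun i => by
    rw [lintegral_ofReal_eq_lintegral_meas_lt _ (hmeas i).aemeasurable]
    refine lintegral_congr fun x => ?_
    rw [Measure.restrict_apply (measurableSet_lt measurable_const (hmeas i)),
      firstEvent_eq i₁ (x : EReal) i]
    simp only [EReal.coe_lt_coe_iff]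
  have hanti : ∀ i, Measurable fun x : ℝ => P (firstEvent τ i₁ (x : EReal) i) := fun i => by
    refine Antitone.measurable fun x y hxy => measure_mono ?_
    rw [firstEvent_eq i₁ (x : EReal), firstEvent_eq i₁ (y : EReal)]
    exact inter_subset_inter_left _ fun ω hω =>
      lt_of_le_of_lt (EReal.coe_le_coe_iff.2 hxy) hω
  simp only [step2]
  rw [← lintegral_finsetSum _ fun i _ => hanti i,
    lintegral_ofReal_eq_lintegral_meas_lt _ hmax.aemeasurable,
    ← lintegral_const_mul' _ _ ENNReal.ofReal_ne_top]
  refine lintegral_mono fun x => ?_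
  -- At level x, the guarantee is used with t = Pr[max v_i > x], although x need not equal τ(t).
  have h1 := h.le_sum_measure_firstEvent hi₁ (y := (x : EReal))
    (t := (Measure.pi D).real {v | (x : EReal) < (maxVal v : EReal)})
    ⟨measureReal_nonneg, measureReal_le_one⟩ fun i => hτ.exceedProb_le_tailProb hn x i
  rw [ENNReal.ofReal_mul h.pos.le, ofReal_measureReal] at h1
  simpa only [EReal.coe_lt_coe_iff] using h1

end Final

end Acceptance

end OrderSelection

theorem mainTheorem1 :
    ∃ α : ℝ,
      -- `α` is the unique solution of its equation in `(0, 1)`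
      (α ∈ Set.Ioo (0 : ℝ) 1 ∧ OrderSelection.AlphaEq α ∧
        ∀ β ∈ Set.Ioo (0 : ℝ) 1, OrderSelection.AlphaEq β → β = α) ∧
      |α - 0.211| < 0.0005 ∧
      |OrderSelection.ratio α - 0.725| < 0.0005 ∧
      ∀ (n : ℕ), 1 ≤ n →
      ∀ (D : Fin n → Measure ℝ),
        (∀ i, IsProbabilityMeasure (D i)) →
        (∀ i x, D i {x} = 0) →
        (∀ i, ∀ᵐ x ∂(D i), 0 ≤ x) →
        -- threshold functions exist, and the following holds for each of them
        (∃ τ : ℝ → EReal, OrderSelection.IsThreshold D τ) ∧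
        ∀ τ : ℝ → EReal, OrderSelection.IsThreshold D τ →
          -- the arrival time distributions are well defined
          (∀ i, (∀ t ∈ Set.Ico (0 : ℝ) 1,
              0 ≤ OrderSelection.arrivalDensity (OrderSelection.ratio α) D τ i t) ∧
            IsProbabilityMeasure (OrderSelection.arrivalLaw (OrderSelection.ratio α) D τ i)) ∧
          -- an item that can play the special role exists, and any such item may be chosen
          (∃ i₁, OrderSelection.exceedProb D τ i₁ 1 = 1) ∧
          ∀ i₁, OrderSelection.exceedProb D τ i₁ 1 = 1 →
            (∀ t ∈ Set.Icc (0 : ℝ) 1,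
              OrderSelection.ratio α * t ≤
                (OrderSelection.runLaw (OrderSelection.ratio α) D τ).real
                  {ω | τ t < (OrderSelection.algValue τ i₁ ω.1 ω.2 : EReal)}) ∧
            ENNReal.ofReal (OrderSelection.ratio α) *
                (∫⁻ v, ENNReal.ofReal (OrderSelection.maxVal v) ∂(Measure.pi D)) ≤
              ∫⁻ ω, ENNReal.ofReal (OrderSelection.algValue τ i₁ ω.1 ω.2)
                ∂(OrderSelection.runLaw (OrderSelection.ratio α) D τ) := by
  obtain ⟨α, hα, hα1, hΓ, hpos, hlt, hB⟩ := OrderSelection.exists_constants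
  refine ⟨α, hα, hα1, hΓ, fun n hn D hprob hatom _ =>
    ⟨OrderSelection.exists_isThreshold hn hatom, fun τ hτ => ?_⟩⟩
  have h : OrderSelection.IsGoodInstance (OrderSelection.ratio α) D τ :=
    ⟨hpos, hlt, hτ.antitoneOn hn, hτ.exceedSystem hn hatom, hB⟩
  exact ⟨fun i => ⟨fun t ht => h.density_nonneg i ht, h.isProbabilityMeasure_arrivalLaw i⟩,
    h.system.exists_eq_one, fun i₁ hi₁ => ⟨fun t ht => h.prob_algValue hi₁ ht,
      h.expectation_algValue hτ hn hi₁⟩⟩
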